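/- Let $\mathbb{K}$ be a field of characteristic zero and let $(V,\cdot,\delta_V,\epsilon_V)$ be a commutative, not necessarily unital, bialgebra over $\mathbb{K}$ (a counital coalgebra with an associative commutative product, $\delta_V$ and $\epsilon_V$ being multiplicative). Write $uV=\mathbb{K}\oplus V$ for its unital extension and $\delta_V(v)=v'\otimes v''$. **The quasishuffle double bialgebra $\mathrm{QSh}(V)$** is the space $T(V)$ of words in $V$, with unit the empty word and * product $v_1\ldots v_k * v_{k+1}\ldots v_{k+l}=\sum_\sigma\bigl(\prod_{\sigma(i)=1}v_i\bigr)\ldots\bigl(\prod_{\sigma(i)=\max\sigma}v_i\bigr)$, over all surjections $\sigma:\{1,\ldots,k+l\}\to\{1,\ldots,\max\sigma\}$ that are strictly increasing on $\{1,\ldots,k\}$ and on $\{k+1,\ldots,k+l\}$; * first coproduct $\Delta(v_1\ldots v_n)=\sum_{k=0}^n v_1\ldots v_k\otimes v_{k+1}\ldots v_n$, whose counit $\varepsilon_\Delta$ is $1$ on the empty word and $0$ on nonempty words; * second coproduct $\delta(v_1\ldots v_n)=\sum\bigl(\prod_{i\in b_1}v_i'\bigr)\ldots\bigl(\prod_{i\in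 b_p}v_i'\bigr)\otimes v''_{b_1}*\cdots*v''_{b_p}$, over all decompositions of $(1,\ldots,n)$ into nonempty consecutive blocks $b_1,\ldots,b_p$, where $v''_b$ is the word of the $v_i''$, $i\in b$; its counit $\epsilon_\delta$ is $1$ on the empty word, $\epsilon_V$ on $V$, and $0$ on longer words; * coaction $\rho(v_1\ldots v_n)=v_1'\ldots v_n'\otimes v_1''\cdots v_n''\in T(V)\otimes uV$. **The double bialgebra $\mathcal{H}_V[\mathbf{G}]$ of $V$-decorated graphs** is the vector space generated by isomorphism classes of finite simple graphs $G$ whose vertices $x$ carry decorations $d(x)\in V$, modulo linearity in each decoration. Its product is the disjoint union and its unit is the empty graph. Further, * $\Delta(G)=\sum_{V(G)=A\sqcup B}G_{|A}\otimes G_{|B}$, and $\varepsilon_\Delta$ is $1$ on the empty graph and $0$ on nonempty graphs; * $\delta(G)=\sum_{\sim}G/{\sim}\otimes G|{\sim}$, over all equivalence relations on $V(G)$ whose classes induce connected subgraphs. In $G/{\sim}$ (the graph obtained by contracting each class to a vertex) a class $w$ is decorated by $\prod_{x\in w}d(x)'$; in $G|{\sim}$ (the graph on $V(G)$ with only the edges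 of $G$ between equivalent vertices) $x$ is decorated by $d(x)''$; * $\epsilon_\delta(G)=\prod_x\epsilon_V(d(x))$ if $G$ has no edge, and $\epsilon_\delta(G)=0$ otherwise; * $\rho(G)\in\mathcal{H}_V[\mathbf{G}]\otimes uV$ is $G$ with decorations $d(x)'$, tensored with $\prod_x d(x)''$. A morphism of double bialgebras over $V$ is a linear map compatible with the units, the products, $\Delta$, $\varepsilon_\Delta$, $\delta$, $\epsilon_\delta$ and $\rho$. **Proposition.** There is a unique morphism $\Phi_1$ of double bialgebras over $V$ from $\mathcal{H}_V[\mathbf{G}]$ to $\mathrm{QSh}(V)$. For every $V$-decorated graph $G$ with decoration $d$, $$\Phi_1(G)=\sum_{c\in\mathcal{C}(G)}\Bigl(\prod_{c(x)=1}d(x)\Bigr)\Bigl(\prod_{c(x)=2}d(x)\Bigr)\ldots\Bigl(\prod_{c(x)=\max(c)}d(x)\Bigr),$$ where each term is a word with $\max(c)$ letters, the products are taken in $V$, and $\mathcal{C}(G)$ is the set of packed valid colourations of $G$, that is, of surjections $c:V(G)\to\{1,\ldots,\max(c)\}$ with $c(x)\neq c(y)$ for every edge $\{x,y\}$ of $G$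 (the empty graph has one such colouration, with $\max(c)=0$). -/

import Mathlib

open scoped TensorProduct

set_option linter.unusedSectionVars false

universe u v w

noncomputable section

namespace GraphQSh

section Algebra

variable (K : Type u) (V : Type v) [Field K] [NonUnitalCommRing V] [Module K V]
  [IsScalarTower K V V] [SMulCommClass K V V]

/-- A not necessarily unital bialgebra: a counital coalgebra whose coproduct and counit are
multiplicative. -/
class IsNonUnitalBialgebra [Coalgebra K V] : Prop where
  counit_mul : ∀ a b : V,
    Coalgebra.counit (R := K) (a * b) = Coalgebra.counit (R := K) a * Coalgebra.counit (R := K) b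
  comul_mul : ∀ a b : V,
    Coalgebra.comul (R := K) (a * b) = Coalgebra.comul (R := K) a * Coalgebra.comul (R := K) b

/-- The unital extension `uV = K ⊕ V`. -/
abbrev UnitalExt : Type (max u v) := Unitization K V

variable {K V}

/-- The product in `uV` of a finite family of elements of `V` (it is `1` for the empty family). -/
def uProd (ι : Type*) [Finite ι] : MultilinearMap K (fun _ : ι => V) (UnitalExt K V) :=
  letI := Fintype.ofFinite ι
  (MultilinearMap.mkPiAlgebra K ι (UnitalExt K V)).compLinearMap
    fun _ => Unitization.inrHom K K V

/-- The product in `V` of a finite nonempty family of elements of `V`: the `V`-component of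
the product in `uV = K ⊕ V`. -/
def dotProd (ι : Type*) [Finite ι] : MultilinearMap K (fun _ : ι => V) V :=
  (Unitization.sndHom K K V).compMultilinearMap (uProd ι)

theorem uProd_apply {ι : Type*} [inst : Fintype ι] (v : ι → V) :
    uProd (K := K) ι v = ∏ i, (v i : Unitization K V) := by
  have e : inst = Fintype.ofFinite ι := Subsingleton.elim _ _
  rw [e]
  simp [uProd]

theorem uProd_eq_dotProd (ι : Type*) [Finite ι] [Nonempty ι] (v : ι → V) :
    uProd (K := K) ι v = (dotProd (K := K) ι v : V) := by
  let _ := Fintype.ofFinite ι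
  have h : (uProd (K := K) ι v).fst = 0 := by
    rw [uProd_apply, ← Unitization.fstHom_apply K, map_prod]
    exact Finset.prod_eq_zero (Finset.mem_univ (Classical.arbitrary ι)) (by simp)
  refine Unitization.ext ?_ ?_
  · simp [h]
  · simp [dotProd]

theorem dotProd_unique (ι : Type*) [Unique ι] (v : ι → V) :
    dotProd (K := K) ι v = v default := by
  simp [dotProd, uProd_apply]

theorem dotProd_option (ι : Type*) [Finite ι] [Nonempty ι] (v : Option ι → V) :
    dotProd (K := K) (Option ι) v = v none * dotProd (K := K) ι (fun i => v (some i)) := by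
  let _ := Fintype.ofFinite ι
  have h := uProd_eq_dotProd (K := K) ι (fun i => v (some i))
  have h' : (uProd (K := K) (Option ι) v) =
      ((v none * dotProd (K := K) ι (fun i => v (some i)) : V) : Unitization K V) := by
    rw [Unitization.inr_mul, ← h, uProd_apply, uProd_apply, Fintype.prod_option]
  simp only [dotProd, LinearMap.compMultilinearMap_apply, h'] at *
  simp

theorem dotProd_equiv {ι ι' : Type*} [Finite ι] [Finite ι'] (e : ι ≃ ι') (v : ι' → V) :
    dotProd (K := K) ι (fun i => v (e i)) = dotProd (K := K) ι' v := by
  let _ := Fintype.ofFinite ι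
  let _ := Fintype.ofFinite ι'
  simp only [dotProd, LinearMap.compMultilinearMap_apply, uProd_apply]
  rw [Equiv.prod_comp e fun i => (v i : Unitization K V)]

theorem uProd_equiv {ι ι' : Type*} [Finite ι] [Finite ι'] (e : ι ≃ ι') (v : ι' → V) :
    uProd (K := K) ι (fun i => v (e i)) = uProd (K := K) ι' v := by
  let _ := Fintype.ofFinite ι
  let _ := Fintype.ofFinite ι'
  simp only [uProd_apply]
  exact Equiv.prod_comp e fun i => (v i : Unitization K V)

/-- Given `c : W → P` and a multilinear map `F` on families indexed by `P`, the map sending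
`(v_x)_{x ∈ W}` to `F ((∏_{c x = p} v_x)_{p ∈ P})`. -/
def fiberwise {W P M : Type*} [Finite W] [AddCommGroup M] [Module K M] (c : W → P)
    (F : MultilinearMap K (fun _ : P => V) M) : MultilinearMap K (fun _ : W => V) M :=
  (F.compMultilinearMap fun p => dotProd {x // c x = p}).domDomCongr (Equiv.sigmaFiberEquiv c)

theorem fiberwise_apply {W P M : Type*} [Finite W] [AddCommGroup M] [Module K M] (c : W → P)
    (F : MultilinearMap K (fun _ : P => V) M) (v : W → V) :
    fiberwise c F v = F fun p => dotProd (K := K) {x // c x = p} fun x => v x := rfl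

section Sweedler

variable [Coalgebra K V] {W M N : Type*} [Finite W] [AddCommGroup M] [Module K M]
  [AddCommGroup N] [Module K N]

open Classical in
/-- The multilinear map `(v_x)_{x ∈ W} ↦ ∑ F ((v_x')_{x ∈ W}) ⊗ G ((v_x'')_{x ∈ W})`,
with Sweedler's notation at each `x ∈ W`; see `sweedler_apply`.  It is obtained by multiplying
the images of `δ_V (v_x) ∈ uV ⊗ uV` in the commutative algebra `(⨂_W uV) ⊗ (⨂_W uV)`. -/
def sweedler (F : MultilinearMap K (fun _ : W => V) M) (G : MultilinearMap K (fun _ : W => V) N) :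
    MultilinearMap K (fun _ : W => V) (M ⊗[K] N) :=
  letI := Fintype.ofFinite W
  (TensorProduct.map
    (PiTensorProduct.lift (F.compLinearMap fun _ => Unitization.sndHom K K V))
    (PiTensorProduct.lift (G.compLinearMap fun _ => Unitization.sndHom K K V))).compMultilinearMap
  ((MultilinearMap.mkPiAlgebra K W
      ((PiTensorProduct K fun _ : W => UnitalExt K V) ⊗[K]
        (PiTensorProduct K fun _ : W => UnitalExt K V))).compLinearMap fun x =>
    (TensorProduct.map
        ((PiTensorProduct.singleAlgHom (R := K) (A := fun _ : W => UnitalExt K V) x).toLinearMap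
          ∘ₗ Unitization.inrHom K K V)
        ((PiTensorProduct.singleAlgHom (R := K) (A := fun _ : W => UnitalExt K V) x).toLinearMap
          ∘ₗ Unitization.inrHom K K V))
      ∘ₗ Coalgebra.comul)

theorem prod_tmul_aux {A B : Type*} [CommRing A] [Algebra K A] [CommRing B] [Algebra K B]
    {ι : Type*} (s : Finset ι) (a : ι → A) (b : ι → B) :
    ∏ i ∈ s, (a i ⊗ₜ[K] b i) = (∏ i ∈ s, a i) ⊗ₜ[K] (∏ i ∈ s, b i) := by
  classical
  induction s using Finset.induction_on with
  | empty => simp [Algebra.TensorProduct.one_def]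
  | insert i s hi ih => simp [Finset.prod_insert hi, ih]

open Classical in
theorem sweedler_apply [inst : Fintype W] (F : MultilinearMap K (fun _ : W => V) M)
    (G : MultilinearMap K (fun _ : W => V) N) (v : W → V) {I : W → Type*} [∀ x, Fintype (I x)]
    (a b : ∀ x, I x → V)
    (h : ∀ x, Coalgebra.comul (R := K) (v x) = ∑ i, a x i ⊗ₜ[K] b x i) :
    sweedler F G v = ∑ s : ∀ x, I x, F (fun x => a x (s x)) ⊗ₜ[K] G (fun x => b x (s x)) := by
  have key : ∀ z : W → UnitalExt K V,
      ∏ x, (PiTensorProduct.singleAlgHom (R := K) (A := fun _ : W => UnitalExt K V) x) (z x)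
        = PiTensorProduct.tprod K z := by
    intro z
    simp only [PiTensorProduct.singleAlgHom_apply]
    have := map_prod (PiTensorProduct.tprodMonoidHom (R := K) (A := fun _ : W => UnitalExt K V))
      (fun x => MonoidHom.mulSingle (fun _ : W => UnitalExt K V) x (z x)) Finset.univ
    simp only [PiTensorProduct.tprodMonoidHom_apply] at this
    rw [← this]
    congr 1
    exact Finset.univ_prod_mulSingle z
  have e : inst = Fintype.ofFinite W := Subsingleton.elim _ _
  subst e
  let _ := Fintype.ofFinite W
  simp only [sweedler, LinearMap.compMultilinearMap_apply, MultilinearMap.compLinearMap_apply,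
    MultilinearMap.mkPiAlgebra_apply, LinearMap.comp_apply, h, map_sum, TensorProduct.map_tmul]
  refine (congrArg _ (Finset.prod_univ_sum (fun x => Finset.univ) _)).trans ?_
  rw [map_sum, Fintype.piFinset_univ]
  refine Finset.sum_congr rfl fun s _ => ?_
  simp only [AlgHom.toLinearMap_apply]
  rw [prod_tmul_aux, key, key]
  simp

end Sweedler

/-- Relabelling the index set commutes with `sweedler`. -/
theorem sweedler_domDomCongr [Coalgebra K V] {W W' M N : Type*} [Finite W] [Finite W']
    [AddCommGroup M] [Module K M] [AddCommGroup N] [Module K N] (e : W ≃ W')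
    (F : MultilinearMap K (fun _ : W => V) M) (G : MultilinearMap K (fun _ : W => V) N) :
    (sweedler F G).domDomCongr e = sweedler (F.domDomCongr e) (G.domDomCongr e) := by
  classical
  let _ := Fintype.ofFinite W
  let _ := Fintype.ofFinite W'
  ext v
  have hrep : ∀ x : W', ∃ (n : ℕ) (a b : Fin n → V),
      Coalgebra.comul (R := K) (v x) = ∑ i, a i ⊗ₜ[K] b i := fun x =>
    TensorProduct.exists_sum_tmul_eq _
  choose n a b h using hrep
  rw [MultilinearMap.domDomCongr_apply,
    sweedler_apply F G (fun i => v (e i)) (fun x => a (e x)) (fun x => b (e x)) (fun x => h (e x)),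
    sweedler_apply _ _ v a b h]
  refine Fintype.sum_equiv (Equiv.piCongrLeft (fun x => Fin (n x)) e) _ _ fun s => ?_
  simp [MultilinearMap.domDomCongr_apply]

end Algebra

section Structures

/-- The structure maps of a double bialgebra over `V`, with coaction `ρ : B → B ⊗ U`, where
`U = uV`. -/
structure DoubleOps (K : Type*) (U B : Type*) [Field K] [AddCommGroup U] [Module K U]
    [AddCommGroup B] [Module K B] where
  /-- the unit `1_B` -/
  one : B
  /-- the product `m` -/
  mul : B →ₗ[K] B →ₗ[K] B
  /-- the coproduct `Δ` -/
  coprodΔ : B →ₗ[K] B ⊗[K] B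
  /-- the counit `ε_Δ` of `Δ` -/
  counitΔ : B →ₗ[K] K
  /-- the coproduct `δ` -/
  coprodδ : B →ₗ[K] B ⊗[K] B
  /-- the counit `ε_δ` of `δ` -/
  counitδ : B →ₗ[K] K
  /-- the coaction `ρ` -/
  coaction : B →ₗ[K] B ⊗[K] U

/-- Morphisms of double bialgebras over `V`: linear maps compatible with the units, the products,
both coproducts and their counits, and the coactions. -/
structure IsDoubleHom {K U B B' : Type*} [Field K] [AddCommGroup U] [Module K U]
    [AddCommGroup B] [Module K B] [AddCommGroup B'] [Module K B']
    (S : DoubleOps K U B) (S' : DoubleOps K U B') (φ : B →ₗ[K] B') : Prop where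
  map_one : φ S.one = S'.one
  map_mul : ∀ x y, φ (S.mul x y) = S'.mul (φ x) (φ y)
  map_coprodΔ : ∀ x, S'.coprodΔ (φ x) = TensorProduct.map φ φ (S.coprodΔ x)
  map_counitΔ : ∀ x, S'.counitΔ (φ x) = S.counitΔ x
  map_coprodδ : ∀ x, S'.coprodδ (φ x) = TensorProduct.map φ φ (S.coprodδ x)
  map_counitδ : ∀ x, S'.counitδ (φ x) = S.counitδ x
  map_coaction : ∀ x, S'.coaction (φ x) = TensorProduct.map φ LinearMap.id (S.coaction x)

end Structures

/-! ### The quasishuffle double bialgebra -/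

section QSh

variable (K : Type u) (V : Type v) [Field K] [NonUnitalCommRing V] [Module K V]
  [IsScalarTower K V V] [SMulCommClass K V V]

/-- The underlying vector space `T(V)` of `QSh(V)`. -/
abbrev QSh : Type (max u v) := TensorAlgebra K V

variable {V}

/-- The word `v_1 … v_n`, as a multilinear map. -/
def word (n : ℕ) : MultilinearMap K (fun _ : Fin n => V) (QSh K V) := TensorAlgebra.tprod K V n

variable {K}

/-- A linear map on `T(V)` is determined by its values on words. -/
theorem QSh.hom_ext {M : Type*} [AddCommGroup M] [Module K M] {f g : QSh K V →ₗ[K] M}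
    (h : ∀ n (v : Fin n → V), f (word K n v) = g (word K n v)) : f = g := by
  have h' : f ∘ₗ TensorAlgebra.equivDirectSum.symm.toLinearMap =
      g ∘ₗ TensorAlgebra.equivDirectSum.symm.toLinearMap := by
    refine DirectSum.linearMap_ext K fun n => PiTensorProduct.ext (MultilinearMap.ext fun v => ?_)
    have := TensorAlgebra.ofDirectSum_of_tprod (R := K) v
    simpa [DirectSum.lof_eq_of, TensorAlgebra.equivDirectSum, this, word] using h n v
  ext x
  have := LinearMap.congr_fun h' (TensorAlgebra.equivDirectSum x)
  simpa using this

/-- The linear map on `T(V)` given by a multilinear map on the words of each length. -/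
def liftWordsFun {M : Type*} [AddCommGroup M] [Module K M]
    (f : ∀ n, MultilinearMap K (fun _ : Fin n => V) M) : QSh K V →ₗ[K] M :=
  DirectSum.toModule K ℕ M (fun n => PiTensorProduct.lift (f n)) ∘ₗ
    TensorAlgebra.equivDirectSum.toLinearMap

theorem liftWordsFun_word {M : Type*} [AddCommGroup M] [Module K M]
    (f : ∀ n, MultilinearMap K (fun _ : Fin n => V) M) (n : ℕ) (v : Fin n → V) :
    liftWordsFun f (word K n v) = f n v := by
  simp only [liftWordsFun, word, LinearMap.comp_apply, AlgEquiv.toLinearMap_apply,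
    TensorAlgebra.equivDirectSum_apply, TensorAlgebra.toDirectSum_tensorPower_tprod]
  rw [← DirectSum.lof_eq_of K, DirectSum.toModule_lof, PiTensorProduct.lift.tprod]

/-- `liftWordsFun`, linear in the family of multilinear maps. -/
def liftWords {M : Type*} [AddCommGroup M] [Module K M] :
    (∀ n, MultilinearMap K (fun _ : Fin n => V) M) →ₗ[K] (QSh K V →ₗ[K] M) where
  toFun := liftWordsFun
  map_add' f g := QSh.hom_ext fun n v => by simp [liftWordsFun_word]
  map_smul' a f := QSh.hom_ext fun n v => by simp [liftWordsFun_word]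

theorem liftWords_word {M : Type*} [AddCommGroup M] [Module K M]
    (f : ∀ n, MultilinearMap K (fun _ : Fin n => V) M) (n : ℕ) (v : Fin n → V) :
    liftWords f (word K n v) = f n v := liftWordsFun_word f n v

/-- The `(k, l)`-quasishuffles `σ : [k] ⊔ [l] → [p]`: surjections which are strictly increasing on
`[k]` and on `[l]`. -/
def Quasishuffle (k l p : ℕ) : Type :=
  {σ : Fin k ⊕ Fin l → Fin p // Function.Surjective σ ∧
    StrictMono (σ ∘ Sum.inl) ∧ StrictMono (σ ∘ Sum.inr)}

instance (k l p : ℕ) : Finite (Quasishuffle k l p) := Subtype.finite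

instance (k l p : ℕ) : Fintype (Quasishuffle k l p) := Fintype.ofFinite _

/-- The quasishuffle of a word of length `k` and a word of length `l`: the sum over all
`(k, l)`-quasishuffles `σ` of the words whose `j`-th letter is `∏_{σ i = j} v_i`. -/
def qshWord (k l : ℕ) : MultilinearMap K (fun _ : Fin k ⊕ Fin l => V) (QSh K V) :=
  ∑ p ∈ Finset.range (k + l + 1), ∑ σ : Quasishuffle k l p, fiberwise σ.1 (word K p)

/-- The quasishuffle product. -/
def qshMul : QSh K V →ₗ[K] QSh K V →ₗ[K] QSh K V :=
  liftWords fun k =>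
    liftWords.compMultilinearMap (MultilinearMap.pi fun l => (qshWord k l).currySum)

theorem qshMul_word (k l : ℕ) (v : Fin k → V) (w : Fin l → V) :
    qshMul (word K k v) (word K l w) =
      ∑ p ∈ Finset.range (k + l + 1), ∑ σ : Quasishuffle k l p,
        word K p fun j => dotProd (K := K) {i // σ.1 i = j} fun i => Sum.elim v w i := by
  simp [qshMul, liftWords_word, qshWord, fiberwise_apply]

/-- The iterated quasishuffle product `w_1 ⧢ (w_2 ⧢ (… ⧢ w_p))`, equal to `1` if `p = 0`. -/
def qshIter : ∀ p : ℕ, MultilinearMap K (fun _ : Fin p => QSh K V) (QSh K V)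
  | 0 => MultilinearMap.constOfIsEmpty K _ 1
  | p + 1 => LinearMap.uncurryLeft
      { toFun := fun x => (qshMul x).compMultilinearMap (qshIter p)
        map_add' := fun x y => by ext; simp
        map_smul' := fun a x => by ext; simp }

/-- Deconcatenation: `Δ(v_1 … v_n) = ∑_{k=0}^n v_1 … v_k ⊗ v_{k+1} … v_n`. -/
def qshΔ : QSh K V →ₗ[K] QSh K V ⊗[K] QSh K V :=
  liftWords fun n => ∑ k : Fin (n + 1),
    ((word K (k : ℕ)).domCoprod (word K (n - k))).domDomCongr
      (finSumFinEquiv.trans (finCongr (Nat.add_sub_of_le (Nat.le_of_lt_succ k.2))))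

/-- The counit of deconcatenation: `1` on the empty word and `0` on the other words. -/
def qshCounitΔ : QSh K V →ₗ[K] K :=
  liftWords fun n => match n with
    | 0 => MultilinearMap.constOfIsEmpty K _ 1
    | _ + 1 => 0

variable [Coalgebra K V]

/-- The coproduct `δ`: the sum over all compositions of the word `v_1 … v_n` into nonempty
consecutive blocks `b_1, …, b_p` of
`(∏_{i ∈ b_1} v_i') … (∏_{i ∈ b_p} v_i') ⊗ (v''_{b_1} ⧢ … ⧢ v''_{b_p})`. -/
def qshδ : QSh K V →ₗ[K] QSh K V ⊗[K] QSh K V :=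
  liftWords fun n => ∑ c : Composition n,
    sweedler (fiberwise c.index (word K c.length))
      (((qshIter c.length).compMultilinearMap fun j => word K (c.blocksFun j)).domDomCongr
        c.blocksFinEquiv)

/-- The counit of `δ`: `1` on the empty word, `ε_V` on `V`, and `0` on longer words. -/
def qshCounitδ : QSh K V →ₗ[K] K :=
  liftWords fun n => match n with
    | 0 => MultilinearMap.constOfIsEmpty K _ 1
    | 1 => (MultilinearMap.mkPiAlgebra K (Fin 1) K).compLinearMap fun _ => Coalgebra.counit
    | _ + 2 => 0

/-- The coaction `ρ(v_1 … v_n) = v_1' … v_n' ⊗ (v_1'' ⋯ v_n'')`, with the empty word sent to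
`1 ⊗ 1`. -/
def qshCoaction : QSh K V →ₗ[K] QSh K V ⊗[K] UnitalExt K V :=
  liftWords fun n => sweedler (word K n) (uProd (Fin n))

variable (K V)

/-- The structure maps of the quasishuffle double bialgebra `QSh(V)`. -/
def qshOps : DoubleOps K (UnitalExt K V) (QSh K V) where
  one := 1
  mul := qshMul
  coprodΔ := qshΔ
  counitΔ := qshCounitΔ
  coprodδ := qshδ
  counitδ := qshCounitδ
  coaction := qshCoaction

end QSh

/-! ### The double bialgebra of `V`-decorated graphs -/

section Graphs

variable (K : Type u) (V : Type v) [Field K] [NonUnitalCommRing V] [Module K V]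
  [IsScalarTower K V V] [SMulCommClass K V V]

/-- A finite graph with vertices decorated by elements of `V`. -/
structure DecGraph where
  W : Type w
  [finite : Finite W]
  graph : SimpleGraph W
  deco : W → V

/-- The relations defining the space of `V`-decorated graphs: isomorphic decorated graphs are
identified, and graphs are linear in the decoration of each vertex. -/
inductive GraphRel : (DecGraph.{v, w} V →₀ K) → Prop
  | iso {W W' : Type w} [Finite W] [Finite W'] (G : SimpleGraph W) (G' : SimpleGraph W')
      (e : G ≃g G') (d : W' → V) :
      GraphRel (Finsupp.single ⟨W, G, d ∘ e⟩ 1 - Finsupp.single ⟨W', G', d⟩ 1)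
  | add {W : Type w} [Finite W] [DecidableEq W] (G : SimpleGraph W) (d : W → V) (x : W)
      (a b : V) :
      GraphRel (Finsupp.single ⟨W, G, Function.update d x (a + b)⟩ 1
        - Finsupp.single ⟨W, G, Function.update d x a⟩ 1
        - Finsupp.single ⟨W, G, Function.update d x b⟩ 1)
  | smul {W : Type w} [Finite W] [DecidableEq W] (G : SimpleGraph W) (d : W → V) (x : W)
      (t : K) (a : V) :
      GraphRel (Finsupp.single ⟨W, G, Function.update d x (t • a)⟩ 1
        - t • Finsupp.single ⟨W, G, Function.update d x a⟩ 1)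

/-- The space `H_V[G]` of `V`-decorated graphs. -/
abbrev GraphAlg : Type (max u v (w + 1)) :=
  (DecGraph.{v, w} V →₀ K) ⧸ Submodule.span K {r | GraphRel K V r}

variable {V}

/-- The class in `H_V[G]` of the graph `G` with decoration `d`, as a multilinear map in `d`. -/
def graphMk {W : Type w} [Finite W] (G : SimpleGraph W) :
    MultilinearMap K (fun _ : W => V) (GraphAlg.{u, v, w} K V) where
  toFun d := Submodule.Quotient.mk (Finsupp.single ⟨W, G, d⟩ 1)
  map_update_add' d x a b := by
    rw [← Submodule.Quotient.mk_add, Submodule.Quotient.eq, ← sub_sub]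
    exact Submodule.subset_span (GraphRel.add G d x a b)
  map_update_smul' d x t a := by
    rw [← Submodule.Quotient.mk_smul, Submodule.Quotient.eq]
    exact Submodule.subset_span (GraphRel.smul G d x t a)

variable {K}

theorem graphMk_iso {W W' : Type w} [Finite W] [Finite W'] {G : SimpleGraph W}
    {G' : SimpleGraph W'} (e : G ≃g G') (d : W' → V) :
    graphMk K G (d ∘ e) = graphMk K G' d :=
  (Submodule.Quotient.eq _).2 (Submodule.subset_span (GraphRel.iso G G' e d))

theorem GraphAlg.hom_ext {M : Type*} [AddCommGroup M] [Module K M]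
    {f g : GraphAlg.{u, v, w} K V →ₗ[K] M}
    (h : ∀ (W : Type w) [Finite W] (G : SimpleGraph W) (d : W → V),
      f (graphMk K G d) = g (graphMk K G d)) : f = g := by
  refine Submodule.linearMap_qext _ (Finsupp.lhom_ext' fun D => LinearMap.ext_ring ?_)
  obtain ⟨W, G, d⟩ := D
  exact h W G d

/-- The linear map on `H_V[G]` given by an isomorphism-invariant family of maps which are
multilinear in the decorations. -/
def liftGraphs {M : Type*} [AddCommGroup M] [Module K M]
    (f : ∀ (W : Type w) [Finite W], SimpleGraph W → MultilinearMap K (fun _ : W => V) M)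
    (hf : ∀ (W W' : Type w) [Finite W] [Finite W'] (G : SimpleGraph W) (G' : SimpleGraph W')
      (e : G ≃g G'), (f W G).domDomCongr e.toEquiv = f W' G') :
    GraphAlg.{u, v, w} K V →ₗ[K] M :=
  Submodule.liftQ _ (Finsupp.linearCombination K fun D : DecGraph.{v, w} V =>
      letI := D.finite
      f D.W D.graph D.deco) <| by
    rw [Submodule.span_le]
    rintro _ (⟨G, G', e, d⟩ | ⟨G, d, x, a, b⟩ | ⟨G, d, x, t, a⟩)
    · have := congrArg (fun F => F d) (hf _ _ G G' e)
      simp only [MultilinearMap.domDomCongr_apply] at this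
      simpa [sub_eq_zero, Function.comp_def, Finsupp.linearCombination_single] using this
    · simp [Finsupp.linearCombination_single]
    · simp [Finsupp.linearCombination_single, -Finsupp.smul_single]

theorem liftGraphs_graphMk {M : Type*} [AddCommGroup M] [Module K M]
    (f : ∀ (W : Type w) [Finite W], SimpleGraph W → MultilinearMap K (fun _ : W => V) M)
    (hf) {W : Type w} [Finite W] (G : SimpleGraph W) (d : W → V) :
    liftGraphs f hf (graphMk K G d) = f W G d := by
  simp only [liftGraphs, graphMk]
  exact (Submodule.liftQ_apply _ _ _).trans (by simp [Finsupp.linearCombination_single])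

theorem graphMk_domDomCongr {W W' : Type w} [Finite W] [Finite W'] (G : SimpleGraph W)
    (G' : SimpleGraph W') (e : G ≃g G') :
    (graphMk (V := V) K G).domDomCongr e.toEquiv = graphMk K G' :=
  MultilinearMap.ext fun d => graphMk_iso e d

/-- The map `x ↦ G x`, as a multilinear function of its decorations. -/
def graphMulLeft {W : Type w} [Finite W] (G : SimpleGraph W) :
    MultilinearMap K (fun _ : W => V) (GraphAlg.{u, v, w} K V →ₗ[K] GraphAlg.{u, v, w} K V) :=
  let f (d : W → V) : GraphAlg.{u, v, w} K V →ₗ[K] GraphAlg.{u, v, w} K V :=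
    liftGraphs (fun _ _ G' => (graphMk K (G ⊕g G')).currySum d) fun W' W'' _ _ G' G'' e => by
      ext d'
      have := graphMk_iso (K := K) (SimpleGraph.Iso.sumCongr (SimpleGraph.Iso.refl (G := G)) e)
        (Sum.elim d d')
      simp only [MultilinearMap.domDomCongr_apply, MultilinearMap.currySum_apply']
      rw [← this]
      congr 1
      ext x
      cases x <;> rfl
  { toFun := f
    map_update_add' := fun d x a b => GraphAlg.hom_ext fun W' _ G' d' => by
      simp [f, liftGraphs_graphMk, -MultilinearMap.currySum_apply']
    map_update_smul' := fun d x t a => GraphAlg.hom_ext fun W' _ G' d' => by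
      simp [f, liftGraphs_graphMk, -MultilinearMap.currySum_apply'] }

theorem graphMulLeft_graphMk {W W' : Type w} [Finite W] [Finite W'] (G : SimpleGraph W)
    (G' : SimpleGraph W') (d : W → V) (d' : W' → V) :
    graphMulLeft G d (graphMk K G' d') = graphMk K (G ⊕g G') (Sum.elim d d') := by
  simp [graphMulLeft, liftGraphs_graphMk]

/-- The product of `H_V[G]`: disjoint union of graphs. -/
def graphMul : GraphAlg.{u, v, w} K V →ₗ[K] GraphAlg.{u, v, w} K V →ₗ[K] GraphAlg.{u, v, w} K V :=
  liftGraphs (fun _ _ G => graphMulLeft (K := K) (V := V) G) fun W W' _ _ G G' e => by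
    refine MultilinearMap.ext fun d => GraphAlg.hom_ext fun W'' _ H d'' => ?_
    have := graphMk_iso (K := K) (SimpleGraph.Iso.sumCongr e (SimpleGraph.Iso.refl (G := H)))
        (Sum.elim d d'')
    rw [MultilinearMap.domDomCongr_apply, graphMulLeft_graphMk, graphMulLeft_graphMk, ← this]
    congr 1
    ext x
    cases x <;> rfl

open Classical in
/-- The summand `G_{|A} ⊗ G_{|V(G) ∖ A}` of `Δ(G)`. -/
def graphΔTerm {W : Type w} [Finite W] (G : SimpleGraph W) (A : Set W) :
    MultilinearMap K (fun _ : W => V) (GraphAlg.{u, v, w} K V ⊗[K] GraphAlg.{u, v, w} K V) :=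
  ((graphMk K (G.induce A)).domCoprod (graphMk K (G.induce Aᶜ))).domDomCongr
    (Equiv.Set.sumCompl A)

theorem graphΔTerm_apply {W : Type w} [Finite W] (G : SimpleGraph W) (A : Set W) (d : W → V) :
    graphΔTerm (K := K) G A d =
      graphMk K (G.induce A) (fun x => d x) ⊗ₜ[K] graphMk K (G.induce Aᶜ) (fun x => d x) := rfl

theorem graphMk_induce_iso {W W' : Type w} [Finite W] [Finite W'] {G : SimpleGraph W}
    {G' : SimpleGraph W'} (e : G ≃g G') (A : Set W) (A' : Set W') (h : ∀ x, x ∈ A ↔ e x ∈ A')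
    (d : W' → V) :
    graphMk K (G.induce A) (fun x => d (e x)) = graphMk K (G'.induce A') (fun x => d x) := by
  let e' : G.induce A ≃g G'.induce A' :=
    { toEquiv := e.toEquiv.subtypeEquiv h
      map_rel_iff' := by
        intro a b
        exact e.map_rel_iff (a := a.1) (b := b.1) }
  exact graphMk_iso (K := K) e' fun x => d x

/-- The coproduct `Δ(G) = ∑_{V(G) = A ⊔ B} G_{|A} ⊗ G_{|B}`. -/
def graphΔ : GraphAlg.{u, v, w} K V →ₗ[K] GraphAlg.{u, v, w} K V ⊗[K] GraphAlg.{u, v, w} K V :=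
  liftGraphs (fun W _ G => letI := Fintype.ofFinite (Set W); ∑ A : Set W, graphΔTerm G A)
    fun W W' _ _ G G' e => by
      let _ := Fintype.ofFinite (Set W)
      let _ := Fintype.ofFinite (Set W')
      ext d
      simp only [MultilinearMap.domDomCongr_apply, sum_apply]
      refine Fintype.sum_equiv (Equiv.Set.congr e.toEquiv) _ _ fun A => ?_
      rw [graphΔTerm_apply, graphΔTerm_apply]
      congr 1
      · exact graphMk_induce_iso e _ _ (by simp) d
      · exact graphMk_induce_iso e _ _ (by simp) d

open Classical in
/-- The counit of `Δ`: `1` on the empty graph and `0` on the other graphs. -/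
def graphCounitΔ : GraphAlg.{u, v, w} K V →ₗ[K] K :=
  liftGraphs (fun W _ _ => if _h : IsEmpty W then MultilinearMap.constOfIsEmpty K _ 1 else 0)
    fun W W' _ _ G G' e => by
      ext d
      by_cases h : IsEmpty W
      · have h' : IsEmpty W' := e.toEquiv.symm.isEmpty
        simp [h, h']
      · have h' : ¬ IsEmpty W' := fun h' => h e.toEquiv.isEmpty
        simp [h, h']

section Contraction

variable {W : Type w}

/-- `G/∼`: two distinct classes are adjacent if some of their elements are adjacent in `G`. -/
def contract (G : SimpleGraph W) (s : Setoid W) : SimpleGraph (Quotient s) where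
  Adj a b := a ≠ b ∧ ∃ x y, Quotient.mk s x = a ∧ Quotient.mk s y = b ∧ G.Adj x y
  symm := ⟨fun _ _ ⟨h, x, y, hx, hy, hxy⟩ => ⟨h.symm, y, x, hy, hx, hxy.symm⟩⟩
  loopless := ⟨fun _ h => h.1 rfl⟩

/-- `G|∼`: only the edges between equivalent vertices are kept. -/
def cut (G : SimpleGraph W) (s : Setoid W) : SimpleGraph W where
  Adj x y := G.Adj x y ∧ s x y
  symm := ⟨fun _ _ h => ⟨h.1.symm, s.symm h.2⟩⟩
  loopless := ⟨fun _ h => G.loopless.irrefl _ h.1⟩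

/-- `E_c[G]`: the equivalence relations on the vertices of `G` all of whose classes induce
connected subgraphs. -/
def ConnEquiv (G : SimpleGraph W) : Type w :=
  {s : Setoid W // ∀ x, (G.induce {y | s x y}).Connected}

instance [Finite W] (G : SimpleGraph W) : Finite (ConnEquiv G) :=
  Finite.of_injective (fun (s : ConnEquiv G) (x y : W) => s.1 x y) fun _ _ h =>
    Subtype.ext (Setoid.ext fun x y => iff_of_eq (congrFun (congrFun h x) y))

instance [Finite W] (G : SimpleGraph W) : Fintype (ConnEquiv G) := Fintype.ofFinite _

end Contraction

theorem fiberwise_contract_equiv {W W' : Type w} [Finite W] [Finite W'] {G : SimpleGraph W}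
    {G' : SimpleGraph W'} (e : G ≃g G') (s : Setoid W) (s' : Setoid W')
    (h : ∀ x y, s x y ↔ s' (e x) (e y)) :
    (fiberwise (Quotient.mk s) (graphMk (V := V) K (contract G s))).domDomCongr e.toEquiv =
      fiberwise (Quotient.mk s') (graphMk K (contract G' s')) := by
  ext d
  let q : Quotient s ≃ Quotient s' := Quotient.congr e.toEquiv h
  have hq : ∀ x, q (Quotient.mk s x) = Quotient.mk s' (e x) := fun _ => rfl
  let e' : contract G s ≃g contract G' s' :=
    { toEquiv := q
      map_rel_iff' := by
        intro a b
        simp only [contract, ne_eq, EmbeddingLike.apply_eq_iff_eq]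
        refine and_congr_right fun _ => ⟨?_, ?_⟩
        · rintro ⟨x, y, hx, hy, hxy⟩
          refine ⟨e.symm x, e.symm y, q.injective ?_, q.injective ?_, ?_⟩
          · rw [hq, e.apply_symm_apply, hx]
          · rw [hq, e.apply_symm_apply, hy]
          · exact e.symm.map_rel_iff.2 hxy
        · rintro ⟨x, y, hx, hy, hxy⟩
          exact ⟨e x, e y, by rw [← hx, hq], by rw [← hy, hq], e.map_rel_iff.2 hxy⟩ }
  rw [MultilinearMap.domDomCongr_apply, fiberwise_apply, fiberwise_apply, ← graphMk_iso e']
  congr 1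
  ext p
  let f : {x // Quotient.mk s x = p} ≃ {y // Quotient.mk s' y = q p} :=
    e.toEquiv.subtypeEquiv fun x => by
      rw [← q.apply_eq_iff_eq, hq]
      rfl
  exact dotProd_equiv (K := K) f fun y => d y

theorem graphMk_cut_equiv {W W' : Type w} [Finite W] [Finite W'] {G : SimpleGraph W}
    {G' : SimpleGraph W'} (e : G ≃g G') (s : Setoid W) (s' : Setoid W')
    (h : ∀ x y, s x y ↔ s' (e x) (e y)) :
    (graphMk (V := V) K (cut G s)).domDomCongr e.toEquiv = graphMk K (cut G' s') := by
  let e' : cut G s ≃g cut G' s' :=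
    { toEquiv := e.toEquiv
      map_rel_iff' := by
        intro a b
        exact and_congr e.map_rel_iff (h a b).symm }
  exact graphMk_domDomCongr (cut G s) (cut G' s') e'

/-- Transport of an element of `E_c[G]` along an isomorphism. -/
def connEquivMap {W W' : Type w} {G : SimpleGraph W} {G' : SimpleGraph W'} (e : G ≃g G')
    (s : ConnEquiv G) : ConnEquiv G' :=
  ⟨Setoid.comap e.symm s.1, fun x => by
    let f : G.induce {y | s.1 (e.symm x) y} ≃g G'.induce {y | Setoid.comap e.symm s.1 x y} :=
      { toEquiv := e.toEquiv.subtypeEquiv fun y => by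
          simp [Setoid.comap_rel]
        map_rel_iff' := by
          intro a b
          exact e.map_rel_iff (a := a.1) (b := b.1) }
    exact f.connected_iff.1 (s.2 (e.symm x))⟩

/-- The bijection between `E_c[G]` and `E_c[G']` given by an isomorphism. -/
def connEquivEquiv {W W' : Type w} {G : SimpleGraph W} {G' : SimpleGraph W'} (e : G ≃g G') :
    ConnEquiv G ≃ ConnEquiv G' where
  toFun := connEquivMap e
  invFun := connEquivMap e.symm
  left_inv s := Subtype.ext <| Setoid.ext fun x y => by
    change s.1 (e.symm (e x)) (e.symm (e y)) ↔ _
    simp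
  right_inv s := Subtype.ext <| Setoid.ext fun x y => by
    change s.1 (e (e.symm x)) (e (e.symm y)) ↔ _
    simp

variable [Coalgebra K V]

/-- The coproduct `δ(G) = ∑_{∼ ∈ E_c[G]} G/∼ ⊗ G|∼`, where a class `w` is decorated by
`∏_{x ∈ w} d(x)'` in `G/∼` and a vertex `x` is decorated by `d(x)''` in `G|∼`. -/
def graphδ : GraphAlg.{u, v, w} K V →ₗ[K] GraphAlg.{u, v, w} K V ⊗[K] GraphAlg.{u, v, w} K V :=
  liftGraphs (fun _ _ G => ∑ s : ConnEquiv G,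
      sweedler (fiberwise (Quotient.mk s.1) (graphMk (V := V) K (contract G s.1)))
        (graphMk K (cut G s.1)))
    fun W W' _ _ G G' e => by
      ext d
      simp only [MultilinearMap.domDomCongr_apply, sum_apply]
      refine Fintype.sum_equiv (connEquivEquiv e) _ _ fun s => ?_
      have h : ∀ x y, s.1 x y ↔ (connEquivEquiv e s).1 (e x) (e y) := fun x y => by
        change _ ↔ s.1 (e.symm (e x)) (e.symm (e y))
        simp
      rw [← fiberwise_contract_equiv e s.1 _ h, ← graphMk_cut_equiv e s.1 _ h,
        ← sweedler_domDomCongr]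
      rfl

/-- The product of the scalars `ε_V (d(x))`. -/
def counitProd (W : Type*) [Finite W] : MultilinearMap K (fun _ : W => V) K :=
  letI := Fintype.ofFinite W
  (MultilinearMap.mkPiAlgebra K W K).compLinearMap fun _ => Coalgebra.counit

theorem counitProd_apply {W : Type*} [inst : Fintype W] (d : W → V) :
    counitProd (K := K) W d = ∏ x, Coalgebra.counit (R := K) (d x) := by
  have e : inst = Fintype.ofFinite W := Subsingleton.elim _ _
  rw [e]
  simp [counitProd]

open Classical in
/-- The counit of `δ`: `∏_x ε_V (d(x))` if `G` has no edge, and `0` otherwise. -/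
def graphCounitδ : GraphAlg.{u, v, w} K V →ₗ[K] K :=
  liftGraphs (fun W _ G => if G = ⊥ then counitProd W else 0)
    fun W W' _ _ G G' e => by
      have h : G = ⊥ ↔ G' = ⊥ := by
        constructor
        · rintro rfl
          ext x y
          simpa using (e.symm.map_rel_iff (a := x) (b := y)).not.1 (by simp)
        · rintro rfl
          ext x y
          simpa using (e.map_rel_iff (a := x) (b := y)).not.1 (by simp)
      let _ := Fintype.ofFinite W
      let _ := Fintype.ofFinite W'
      ext d
      by_cases hG : G = ⊥
      · simp only [hG, h.1 hG, MultilinearMap.domDomCongr_apply, if_true, counitProd_apply]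
        exact Equiv.prod_comp e.toEquiv fun x => Coalgebra.counit (R := K) (d x)
      · have hG' : ¬ G' = ⊥ := fun h' => hG (h.2 h')
        simp [hG, hG']

/-- The coaction: `ρ(G)` is `G` decorated by the `d(x)'`, tensored with `∏_x d(x)''`. -/
def graphCoaction : GraphAlg.{u, v, w} K V →ₗ[K] GraphAlg.{u, v, w} K V ⊗[K] UnitalExt K V :=
  liftGraphs (fun W _ G => sweedler (graphMk K G) (uProd W)) fun W W' _ _ G G' e => by
    rw [sweedler_domDomCongr, graphMk_domDomCongr G G' e]
    congr 1
    ext1 d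
    exact uProd_equiv e.toEquiv d

variable (K V)

/-- The structure maps of the double bialgebra `H_V[G]` of `V`-decorated graphs. -/
def graphOps : DoubleOps K (UnitalExt K V) (GraphAlg.{u, v, w} K V) where
  one := graphMk K (⊥ : SimpleGraph PEmpty.{w + 1}) fun x => x.elim
  mul := graphMul
  coprodΔ := graphΔ
  counitΔ := graphCounitΔ
  coprodδ := graphδ
  counitδ := graphCounitδ
  coaction := graphCoaction

end Graphs

/-- A packed valid colouration of a graph: a surjection `c` from the vertices onto
`{0, …, max - 1}` such that adjacent vertices have different colours. -/
structure PackedColouring {W : Type*} (G : SimpleGraph W) where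
  max : ℕ
  colour : W → Fin max
  surjective : Function.Surjective colour
  valid : ∀ x y, G.Adj x y → colour x ≠ colour y

instance {W : Type*} [Finite W] (G : SimpleGraph W) : Finite (PackedColouring G) := by
  refine Finite.of_injective
    (β := Σ k : Fin (Nat.card W + 1), (W → Fin k))
    (fun c => ⟨⟨c.max, Nat.lt_succ_of_le ?_⟩, c.colour⟩) ?_
  · simpa using Nat.card_le_card_of_surjective c.colour c.surjective
  · rintro ⟨k, c, _, _⟩ ⟨k', c', _, _⟩ h
    simp only [Sigma.mk.injEq, Fin.mk.injEq] at h
    obtain ⟨rfl, h⟩ := h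
    obtain rfl := eq_of_heq h
    rfl

instance {W : Type*} [Finite W] (G : SimpleGraph W) : Fintype (PackedColouring G) :=
  Fintype.ofFinite _

end GraphQSh

end

open GraphQSh

/-! A word with letters `∏_{c x = j} d x` is attached to a packed map `c`, and a packed map is the
same thing as the strict weak order it induces on the vertices (`PackedMap.ext_lt`). Conversely, any
map to a linear order can be packed by replacing values with ranks (`PackedMap.exists_pack`).
Compatibility of the colouring sum with the products and coproducts thus becomes a bijection between
families of packed maps.

A colouring of a disjoint union is a pair of colourings together with a quasishuffle of their
colours (`qshMul_packedSum`). Cutting a colouring at a threshold `k` splits the vertices into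
colours below `k` and the others, which gives `Δ` (`colouringMap_coprodΔ`). For `δ`, both sides are
sums over the pairs `(f, g)` of packed maps that are not both constant on any edge. On the side of
words, the colouring is recovered as the lexicographic order of `(f, g)` (`qshδ_packedSum`). On the
side of graphs, the equivalence is recovered as connectedness through edges on which `f` is constant
(`colouringMap_graphδ`). Decorations follow because `δ_V` is multiplicative, so that Sweedler sums
commute with products along fibres (`fiberwise_sweedler`); this also settles `ρ`.

For uniqueness, the projection of `T(V)` onto words of length one is `ε_δ ⊗ id` applied after `ρ`,
followed by `uV → V`. Its composite with a morphism is therefore prescribed (`wordProj_map`). A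
tensor is recovered from its `ε_Δ` and from `Δ` by projecting the left factor onto `V` and
concatenating (`eq_counit_add_mul_deconcatenation`). The value on a graph is then determined by the
values on proper induced subgraphs. -/

noncomputable section

namespace GraphQSh

/-! ### Products along fibres and their compatibility with the coproduct of `V` -/

section Fibres

variable {K : Type u} {V : Type v} [Field K] [NonUnitalCommRing V] [Module K V]
  [IsScalarTower K V V] [SMulCommClass K V V]

variable (K) in
/-- The family `(∏_{c x = p} d_x)_{p ∈ P}`. -/
def fiberProd {W P : Type*} [Finite W] (c : W → P) (d : W → V) (p : P) : V :=
  dotProd (K := K) {x // c x = p} fun x => d x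

theorem fiberwise_apply' {W P M : Type*} [Finite W] [AddCommGroup M] [Module K M] (c : W → P)
    (F : MultilinearMap K (fun _ : P => V) M) (d : W → V) :
    fiberwise c F d = F (fiberProd K c d) := rfl

/-- The computation takes place in `uV`, where empty products are `1`, so fibres of `g` may be
empty. Fibres of `c` may not: an empty `dotProd` is `0` in `V`, whence the surjectivity of `c`. -/
theorem uProd_fiberProd {W P Q : Type*} [Finite W] [Finite P] {c : W → P}
    (hc : Function.Surjective c) (g : P → Q) (d : W → V) (q : Q) :
    uProd (K := K) {p // g p = q} (fun p => fiberProd K c d p) =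
      uProd (K := K) {x // g (c x) = q} fun x => d x := by
  classical
  let _ := Fintype.ofFinite W
  let _ := Fintype.ofFinite P
  have h : ∀ p, ((fiberProd K c d p : V) : Unitization K V) =
      ∏ x : {x // c x = p}, (d x : Unitization K V) := fun p => by
    obtain ⟨x, hx⟩ := hc p
    have : Nonempty {x // c x = p} := ⟨⟨x, hx⟩⟩
    rw [fiberProd, ← uProd_eq_dotProd, uProd_apply]
  let e : (Σ p : {p // g p = q}, {x // c x = p.1}) ≃ {x // g (c x) = q} :=
    { toFun := fun s => ⟨s.2.1, by rw [s.2.2, s.1.2]⟩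
      invFun := fun x => ⟨⟨c x, x.2⟩, x, rfl⟩
      left_inv := by
        rintro ⟨⟨p, hp⟩, ⟨x, hx⟩⟩
        obtain rfl : c x = p := hx
        rfl
      right_inv := fun x => rfl }
  simp only [uProd_apply, h]
  rw [← Equiv.prod_comp e, Fintype.prod_sigma]
  rfl

theorem fiberProd_comp {W P Q : Type*} [Finite W] [Finite P] {c : W → P}
    (hc : Function.Surjective c) (g : P → Q) (d : W → V) :
    fiberProd K g (fiberProd K c d) = fiberProd K (g ∘ c) d := by
  ext q
  have := uProd_fiberProd (K := K) hc g d q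
  simp only [fiberProd, dotProd, LinearMap.compMultilinearMap_apply, Function.comp_apply] at this ⊢
  rw [this]

theorem fiberwise_comp {W P Q M : Type*} [Finite W] [Finite P] [AddCommGroup M] [Module K M]
    {c : W → P} (hc : Function.Surjective c) (g : P → Q)
    (F : MultilinearMap K (fun _ : Q => V) M) :
    fiberwise c (fiberwise g F) = fiberwise (g ∘ c) F := by
  ext d
  simp only [fiberwise_apply', fiberProd_comp hc]

theorem uProd_fiberwise {W P : Type*} [Finite W] [Finite P] {c : W → P}
    (hc : Function.Surjective c) : fiberwise c (uProd (K := K) (V := V) P) = uProd W := by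
  ext1 d
  have := uProd_fiberProd (K := K) hc (fun _ => ()) d ()
  rw [fiberwise_apply',
    ← uProd_equiv (Equiv.subtypeUnivEquiv fun _ : P => (rfl : () = ())) (fiberProd K c d),
    ← uProd_equiv (Equiv.subtypeUnivEquiv fun _ : W => (rfl : () = ())) d]
  exact this

theorem fiberProd_id {W : Type*} [Finite W] (d : W → V) : fiberProd K id d = d := by
  ext x
  let _ : Unique {y : W // id y = x} := ⟨⟨⟨x, rfl⟩⟩, fun y => Subtype.ext y.2⟩
  rw [fiberProd, dotProd_unique]
  rfl

theorem fiberProd_equiv {W W' P : Type*} [Finite W] [Finite W'] (e : W ≃ W') (c : W' → P)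
    (d : W' → V) : fiberProd K (c ∘ e) (d ∘ e) = fiberProd K c d := by
  ext p
  exact dotProd_equiv (K := K) (e.subtypeEquiv (p := fun x => c (e x) = p)
    (q := fun x => c x = p) fun _ => Iff.rfl) fun x => d x

theorem fiberProd_sumMap {W W' P P' : Type*} [Finite W] [Finite W'] (c : W → P) (c' : W' → P')
    (d : W → V) (d' : W' → V) :
    fiberProd K (Sum.map c c') (Sum.elim d d') =
      Sum.elim (fiberProd K c d) (fiberProd K c' d') := by
  ext p
  rcases p with p | p
  · let e : {x // c x = p} ≃ {y // Sum.map c c' y = Sum.inl p} :=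
      { toFun := fun x => ⟨Sum.inl x, by simp [x.2]⟩
        invFun := fun y => match y with
          | ⟨Sum.inl x, h⟩ => ⟨x, by simpa using h⟩
          | ⟨Sum.inr x, h⟩ => by simp at h
        left_inv := fun x => rfl
        right_inv := fun y => match y with
          | ⟨Sum.inl x, h⟩ => rfl
          | ⟨Sum.inr x, h⟩ => by simp at h }
    exact (dotProd_equiv (K := K) e fun y => Sum.elim d d' y).symm
  · let e : {x // c' x = p} ≃ {y // Sum.map c c' y = Sum.inr p} :=
      { toFun := fun x => ⟨Sum.inr x, by simp [x.2]⟩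
        invFun := fun y => match y with
          | ⟨Sum.inr x, h⟩ => ⟨x, by simpa using h⟩
          | ⟨Sum.inl x, h⟩ => by simp at h
        left_inv := fun x => rfl
        right_inv := fun y => match y with
          | ⟨Sum.inr x, h⟩ => rfl
          | ⟨Sum.inl x, h⟩ => by simp at h }
    exact (dotProd_equiv (K := K) e fun y => Sum.elim d d' y).symm

variable [Coalgebra K V]

section Bilinear

variable {W M N M' N' : Type*} [Finite W] [AddCommGroup M] [Module K M]
  [AddCommGroup N] [Module K N] [AddCommGroup M'] [Module K M'] [AddCommGroup N'] [Module K N']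

variable (K) in
theorem exists_comul_eq_sum (d : W → V) : ∃ (n : W → ℕ) (a b : ∀ x, Fin (n x) → V),
    ∀ x, Coalgebra.comul (R := K) (d x) = ∑ i, a x i ⊗ₜ[K] b x i := by
  have hrep : ∀ x : W, ∃ (n : ℕ) (a b : Fin n → V),
      Coalgebra.comul (R := K) (d x) = ∑ i, a i ⊗ₜ[K] b i := fun x =>
    TensorProduct.exists_sum_tmul_eq _
  choose n a b h using hrep
  exact ⟨n, a, b, h⟩

theorem sweedler_sum_left {ι : Type*} [Fintype ι] (F : ι → MultilinearMap K (fun _ : W => V) M)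
    (G : MultilinearMap K (fun _ : W => V) N) :
    sweedler (∑ i, F i) G = ∑ i, sweedler (F i) G := by
  classical
  let _ := Fintype.ofFinite W
  ext d
  obtain ⟨n, a, b, h⟩ := exists_comul_eq_sum K d
  simp only [sum_apply, sweedler_apply _ _ d a b h, TensorProduct.sum_tmul]
  rw [Finset.sum_comm]

theorem sweedler_sum_right {ι : Type*} [Fintype ι] (F : MultilinearMap K (fun _ : W => V) M)
    (G : ι → MultilinearMap K (fun _ : W => V) N) :
    sweedler F (∑ i, G i) = ∑ i, sweedler F (G i) := by
  classical
  let _ := Fintype.ofFinite W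
  ext d
  obtain ⟨n, a, b, h⟩ := exists_comul_eq_sum K d
  simp only [sum_apply, sweedler_apply _ _ d a b h, TensorProduct.tmul_sum]
  rw [Finset.sum_comm]

theorem map_sweedler (φ : M →ₗ[K] M') (ψ : N →ₗ[K] N') (F : MultilinearMap K (fun _ : W => V) M)
    (G : MultilinearMap K (fun _ : W => V) N) (d : W → V) :
    TensorProduct.map φ ψ (sweedler F G d) =
      sweedler (φ.compMultilinearMap F) (ψ.compMultilinearMap G) d := by
  classical
  let _ := Fintype.ofFinite W
  obtain ⟨n, a, b, h⟩ := exists_comul_eq_sum K d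
  simp [sweedler_apply _ _ d a b h]

end Bilinear

variable [IsNonUnitalBialgebra K V]

/-- The coproduct of `V`, extended to a morphism of unital algebras `uV → uV ⊗ uV`. -/
def unitizationComul : Unitization K V →ₐ[K] Unitization K V ⊗[K] Unitization K V :=
  Unitization.lift
    { toFun := fun a => TensorProduct.map (Unitization.inrHom K K V) (Unitization.inrHom K K V)
        (Coalgebra.comul (R := K) a)
      map_smul' := fun t a => by simp
      map_zero' := by simp
      map_add' := fun a b => by simp
      map_mul' := fun a b => by
        rw [IsNonUnitalBialgebra.comul_mul]
        generalize Coalgebra.comul (R := K) a = x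
        generalize Coalgebra.comul (R := K) b = y
        induction x using TensorProduct.induction_on with
        | zero => simp
        | add x x' hx hx' => simp only [add_mul, map_add, hx, hx']
        | tmul a a' =>
          induction y using TensorProduct.induction_on with
          | zero => simp
          | add y y' hy hy' => simp only [mul_add, map_add, hy, hy']
          | tmul b b' => simp [Algebra.TensorProduct.tmul_mul_tmul] }

theorem unitizationComul_inr (a : V) : unitizationComul (K := K) (a : Unitization K V) =
    TensorProduct.map (Unitization.inrHom K K V) (Unitization.inrHom K K V)
      (Coalgebra.comul (R := K) a) := by
  simp [unitizationComul]

/-- In `uV ⊗ uV` this is the expansion of a product of sums, by multiplicativity of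
`unitizationComul`. It descends to `V ⊗ V` because the inclusion `V ⊗ V → uV ⊗ uV` has the
projection as a left inverse. -/
theorem comul_dotProd {ι : Type*} [Fintype ι] [DecidableEq ι] [Nonempty ι] (d : ι → V)
    {I : ι → Type*} [∀ x, Fintype (I x)] (a b : ∀ x, I x → V)
    (h : ∀ x, Coalgebra.comul (R := K) (d x) = ∑ i, a x i ⊗ₜ[K] b x i) :
    Coalgebra.comul (R := K) (dotProd (K := K) ι d) =
      ∑ s : ∀ x, I x, dotProd (K := K) ι (fun x => a x (s x)) ⊗ₜ[K]
        dotProd (K := K) ι (fun x => b x (s x)) := by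
  have key : TensorProduct.map (Unitization.inrHom K K V) (Unitization.inrHom K K V)
      (Coalgebra.comul (R := K) (dotProd (K := K) ι d)) =
      TensorProduct.map (Unitization.inrHom K K V) (Unitization.inrHom K K V)
      (∑ s : ∀ x, I x, dotProd (K := K) ι (fun x => a x (s x)) ⊗ₜ[K]
        dotProd (K := K) ι (fun x => b x (s x))) := by
    rw [← unitizationComul_inr, ← uProd_eq_dotProd, uProd_apply, map_prod]
    simp only [unitizationComul_inr, h, map_sum, TensorProduct.map_tmul]
    refine (Finset.prod_univ_sum (fun x => Finset.univ) _).trans ?_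
    rw [Fintype.piFinset_univ]
    refine Finset.sum_congr rfl fun s _ => ?_
    rw [prod_tmul_aux]
    simp only [Unitization.inrHom_apply, ← uProd_eq_dotProd, uProd_apply]
  have hid : Unitization.sndHom K K V ∘ₗ Unitization.inrHom K K V = LinearMap.id := by
    ext; simp
  refine Function.LeftInverse.injective (g := TensorProduct.map (Unitization.sndHom K K V)
    (Unitization.sndHom K K V)) (fun z => ?_) key
  rw [← LinearMap.comp_apply, ← TensorProduct.map_comp, hid, TensorProduct.map_id,
    LinearMap.id_apply]

theorem counit_dotProd {ι : Type*} [Fintype ι] [Nonempty ι] (d : ι → V) :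
    Coalgebra.counit (R := K) (dotProd (K := K) ι d) = ∏ x, Coalgebra.counit (R := K) (d x) := by
  let ε : Unitization K V →ₐ[K] K := Unitization.lift
    { toFun := fun a => Coalgebra.counit (R := K) a
      map_smul' := fun t a => by simp
      map_zero' := by simp
      map_add' := fun a b => by simp
      map_mul' := IsNonUnitalBialgebra.counit_mul }
  have hε : ∀ a : V, ε a = Coalgebra.counit (R := K) a := fun a => by simp [ε]
  rw [← hε, ← uProd_eq_dotProd, uProd_apply, map_prod]
  simp only [hε]

/-- By multiplicativity of `δ_V`, a choice of a tensor summand for every fibre product is a choice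
for every element of every fibre, that is, for every element of `W`. -/
theorem fiberwise_sweedler {W P M N : Type*} [Finite W] [Finite P] [AddCommGroup M] [Module K M]
    [AddCommGroup N] [Module K N] {c : W → P} (hc : Function.Surjective c)
    (F : MultilinearMap K (fun _ : P => V) M) (G : MultilinearMap K (fun _ : P => V) N) :
    fiberwise c (sweedler F G) = sweedler (fiberwise c F) (fiberwise c G) := by
  classical
  let _ := Fintype.ofFinite W
  let _ := Fintype.ofFinite P
  ext d
  obtain ⟨n, a, b, h⟩ := exists_comul_eq_sum K d
  have h' : ∀ p, Coalgebra.comul (R := K) (fiberProd K c d p) =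
      ∑ s : ∀ x : {x // c x = p}, Fin (n x),
        dotProd (K := K) {x // c x = p} (fun x => a x (s x)) ⊗ₜ[K]
          dotProd (K := K) {x // c x = p} (fun x => b x (s x)) := fun p => by
    obtain ⟨x, hx⟩ := hc p
    have : Nonempty {x // c x = p} := ⟨⟨x, hx⟩⟩
    exact comul_dotProd _ _ _ fun x => h x
  rw [fiberwise_apply', sweedler_apply _ _ d a b h, sweedler_apply _ _ (fiberProd K c d) _ _ h']
  let e : (∀ x, Fin (n x)) ≃ (∀ p, ∀ x : {x // c x = p}, Fin (n x)) :=
    { toFun := fun t p x => t x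
      invFun := fun s x => s (c x) ⟨x, rfl⟩
      left_inv := fun t => rfl
      right_inv := fun s => by
        funext p ⟨x, hx⟩
        subst hx
        rfl }
  exact (Fintype.sum_equiv e _ _ fun t => rfl).symm

end Fibres

/-! ### Packed maps and their strict weak orders -/

/-- A packed map: a surjection of `W` onto `{0, …, max - 1}`. -/
structure PackedMap (W : Type*) where
  max : ℕ
  toFun : W → Fin max
  surj : Function.Surjective toFun

namespace PackedMap

variable {W W' : Type*}

/-- The strict weak order on `W` defined by a packed map. -/
def lt (c : PackedMap W) (x y : W) : Prop := c.toFun x < c.toFun y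

/-- Matching the values of `c` and `c'` gives a strictly increasing surjection `Fin n → Fin n'`,
hence the identity. This extensionality principle avoids comparing maps into different types `Fin
n`, and makes injectivity checks below statements about orders. -/
theorem ext_lt {c c' : PackedMap W} (h : ∀ x y, c.lt x y ↔ c'.lt x y) : c = c' := by
  obtain ⟨n, c, hc⟩ := c
  obtain ⟨n', c', hc'⟩ := c'
  simp only [lt] at h
  let m : Fin n → Fin n' := fun i => c' (Function.surjInv hc i)
  -- The chosen preimage of `c x` and `x` itself are incomparable for `c`, hence for `c'`.
  have hm : ∀ x, m (c x) = c' x := fun x => by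
    have := Function.surjInv_eq hc (c x)
    rcases lt_trichotomy (m (c x)) (c' x) with h' | h' | h'
    · have := (h _ _).2 h'
      omega
    · exact h'
    · have := (h _ _).2 h'
      omega
  have hmono : StrictMono m := fun i j hij => by
    obtain ⟨x, rfl⟩ := hc i
    obtain ⟨y, rfl⟩ := hc j
    rw [hm, hm]
    exact (h x y).1 hij
  have hsurj : Function.Surjective m := fun i => by
    obtain ⟨x, rfl⟩ := hc' i
    exact ⟨c x, hm x⟩
  have hn : n = n' := by
    simpa using Fintype.card_of_bijective ⟨hmono.injective, hsurj⟩
  subst hn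
  have hid : m = id := (StrictMono.range_inj hmono strictMono_id).1 (by
    rw [hsurj.range_eq, Set.range_id])
  have : c = c' := funext fun x => by rw [← hm x, hid, id]
  subst this
  rfl

/-- Values are replaced by their ranks in the image of `f`. This supplies the preimages in the
surjectivity arguments for products and for the second coproduct. -/
theorem exists_pack [Finite W] {L : Type*} [LinearOrder L] (f : W → L) :
    ∃ (c : PackedMap W) (a : Fin c.max → L), StrictMono a ∧ ∀ x, a (c.toFun x) = f x := by
  classical
  let _ := Fintype.ofFinite W
  let s := Finset.univ.image f
  let e := s.orderIsoOfFin rfl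
  refine ⟨⟨s.card, fun x => e.symm ⟨f x, Finset.mem_image_of_mem f (Finset.mem_univ x)⟩,
    fun i => ?_⟩, fun i => e i, fun i j hij => e.strictMono hij, fun x => by simp⟩
  obtain ⟨x, -, hx⟩ := Finset.mem_image.1 (e i).2
  exact ⟨x, by simp [hx]⟩

/-- Precomposition of a packed map with a surjection. -/
def comp (σ : PackedMap W') {f : W → W'} (hf : Function.Surjective f) : PackedMap W :=
  ⟨σ.max, σ.toFun ∘ f, σ.surj.comp hf⟩

theorem comp_lt (σ : PackedMap W') {f : W → W'} (hf : Function.Surjective f) (x y : W) :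
    (σ.comp hf).lt x y ↔ σ.lt (f x) (f y) := Iff.rfl

theorem comp_injective {f : W → W'} (hf : Function.Surjective f) {σ τ : PackedMap W'}
    (h : σ.comp hf = τ.comp hf) : σ = τ :=
  ext_lt fun x y => by
    obtain ⟨x, rfl⟩ := hf x
    obtain ⟨y, rfl⟩ := hf y
    rw [← comp_lt σ hf, h, comp_lt]

theorem max_le_card [Finite W] (c : PackedMap W) : c.max ≤ Nat.card W := by
  simpa using Nat.card_le_card_of_surjective c.toFun c.surj

instance [Finite W] : Finite (PackedMap W) :=
  Finite.of_injective (fun c : PackedMap W => c.lt) fun _ _ h =>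
    ext_lt fun x y => iff_of_eq (congrFun (congrFun h x) y)

theorem lt_or_lt_iff (c : PackedMap W) (x y : W) :
    c.lt x y ∨ c.lt y x ↔ c.toFun x ≠ c.toFun y := lt_or_lt_iff_ne

end PackedMap

/-- The packed maps whose strict weak order satisfies a given property. -/
@[ext]
structure PackedMapSet {W : Type*} (P : (W → W → Prop) → Prop) where
  map : PackedMap W
  prop : P map.lt

instance {W : Type*} [Finite W] (P : (W → W → Prop) → Prop) : Finite (PackedMapSet P) :=
  Finite.of_injective PackedMapSet.map fun _ _ => PackedMapSet.ext

instance {W : Type*} [Finite W] (P : (W → W → Prop) → Prop) : Fintype (PackedMapSet P) :=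
  Fintype.ofFinite _

/-! ### Sums over packed maps and the quasishuffle product -/

section PackedSum

variable (K : Type u) {V : Type v} [Field K] [NonUnitalCommRing V] [Module K V]
  [IsScalarTower K V V] [SMulCommClass K V V]

/-- The word whose `j`-th letter is `∏_{c x = j} v_x`. -/
def packedWord {W : Type*} [Finite W] (c : PackedMap W) :
    MultilinearMap K (fun _ : W => V) (QSh K V) := fiberwise c.toFun (word K c.max)

variable {K} in
theorem packedWord_apply {W : Type*} [Finite W] (c : PackedMap W) (d : W → V) :
    packedWord K c d = word K c.max (fiberProd K c.toFun d) := rfl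

variable {K} in
theorem fiberwise_packedWord {W W' : Type*} [Finite W] [Finite W'] {f : W → W'}
    (hf : Function.Surjective f) (σ : PackedMap W') :
    fiberwise f (packedWord (V := V) K σ) = packedWord K (σ.comp hf) := by
  rw [packedWord, fiberwise_comp hf]
  rfl

/-- The sum of the words associated with the packed maps with a given property. -/
def packedSum {W : Type*} [Finite W] (P : (W → W → Prop) → Prop) :
    MultilinearMap K (fun _ : W => V) (QSh K V) := ∑ c : PackedMapSet P, packedWord K c.map

variable {K}

theorem packedSum_apply {W : Type*} [Finite W] (P : (W → W → Prop) → Prop) (d : W → V) :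
    packedSum K P d = ∑ c : PackedMapSet P, packedWord K c.map d := by
  simp [packedSum]

/-- Since the condition on a packed map only involves its order, relabelling the vertices amounts to
pulling back relations. -/
theorem packedSum_equiv {W W' : Type*} [Finite W] [Finite W'] (e : W ≃ W')
    (P : (W → W → Prop) → Prop) (d : W' → V) :
    packedSum K P (d ∘ e) = packedSum K (fun R => P fun x y => R (e x) (e y)) d := by
  rw [packedSum_apply, packedSum_apply]
  symm
  refine Fintype.sum_bijective
    (fun c : PackedMapSet (fun R : W' → W' → Prop => P fun x y => R (e x) (e y)) =>
      (⟨c.1.comp e.surjective, c.2⟩ : PackedMapSet P)) ⟨?_, ?_⟩ _ _ fun c => ?_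
  · intro c c' h
    exact PackedMapSet.ext (PackedMap.comp_injective e.surjective (congrArg PackedMapSet.map h))
  · intro c
    have h : (c.1.comp e.symm.surjective).comp e.surjective = c.1 :=
      PackedMap.ext_lt fun x y => by simp [PackedMap.comp_lt]
    exact ⟨⟨c.1.comp e.symm.surjective, by
      have := c.2
      rw [← h] at this
      exact this⟩, PackedMapSet.ext h⟩
  · rw [packedWord_apply, packedWord_apply]
    exact congrArg _ (fiberProd_equiv e c.1.toFun d).symm

theorem packedSum_congr {W : Type*} [Finite W] {P Q : (W → W → Prop) → Prop}
    (h : ∀ R, P R ↔ Q R) : packedSum (V := V) K P = packedSum K Q := by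
  obtain rfl : P = Q := funext fun R => propext (h R)
  rfl

theorem packedSum_eq_packedWord {W : Type*} [Finite W] {P : (W → W → Prop) → Prop}
    (c : PackedMap W) (hc : ∀ c' : PackedMap W, P c'.lt ↔ c' = c) :
    packedSum (V := V) K P = packedWord K c := by
  have : Subsingleton (PackedMapSet P) :=
    ⟨fun a b => PackedMapSet.ext (((hc _).1 a.2).trans ((hc _).1 b.2).symm)⟩
  exact Fintype.sum_subsingleton _ (⟨c, (hc c).2 rfl⟩ : PackedMapSet P)

/-- The identity of `Fin n` as a packed map. -/
def PackedMap.id (n : ℕ) : PackedMap (Fin n) := ⟨n, _root_.id, Function.surjective_id⟩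

theorem packedWord_id (n : ℕ) : packedWord (V := V) K (PackedMap.id n) = word K n := by
  ext d
  rw [packedWord_apply]
  exact congrArg _ (fiberProd_id d)

/-- The identity is the only strictly increasing packed map on `Fin n`. Single words thus become
instances of `packedSum`, to which the product formulas apply. -/
theorem packedSum_strictMono (n : ℕ) :
    packedSum (V := V) K (fun R : Fin n → Fin n → Prop => ∀ i j, i < j → R i j) = word K n := by
  rw [packedSum_eq_packedWord (PackedMap.id n) fun c => ?_, packedWord_id]
  refine ⟨fun h => PackedMap.ext_lt fun i j => ⟨fun hij => ?_, h i j⟩, ?_⟩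
  · by_contra hn
    have hmono : StrictMono c.toFun := fun i j hij => h i j hij
    exact hn (hmono.lt_iff_lt.1 hij)
  · rintro rfl i j hij
    exact hij

/-- The property of being strictly increasing on `Fin k` and on `Fin l`. -/
def SumStrictMono (k l : ℕ) (R : Fin k ⊕ Fin l → Fin k ⊕ Fin l → Prop) : Prop :=
  (∀ i j, i < j → R (Sum.inl i) (Sum.inl j)) ∧ (∀ i j, i < j → R (Sum.inr i) (Sum.inr j))

theorem SumStrictMono.inl_iff {k l : ℕ} {σ : PackedMap (Fin k ⊕ Fin l)}
    (h : SumStrictMono k l σ.lt) (i j : Fin k) : σ.lt (Sum.inl i) (Sum.inl j) ↔ i < j :=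
  StrictMono.lt_iff_lt (f := fun i => σ.toFun (Sum.inl i)) fun i j => h.1 i j

theorem SumStrictMono.inr_iff {k l : ℕ} {σ : PackedMap (Fin k ⊕ Fin l)}
    (h : SumStrictMono k l σ.lt) (i j : Fin l) : σ.lt (Sum.inr i) (Sum.inr j) ↔ i < j :=
  StrictMono.lt_iff_lt (f := fun i => σ.toFun (Sum.inr i)) fun i j => h.2 i j

/-- Surjectivity bounds the number of values by `k + l`, so the quasishuffles of all target sizes
exhaust the packed maps that increase strictly on both summands. -/
theorem qshMul_word_word (k l : ℕ) (d : Fin k → V) (d' : Fin l → V) :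
    qshMul (word K k d) (word K l d') =
      packedSum K (SumStrictMono k l) (Sum.elim d d') := by
  rw [qshMul_word, packedSum_apply, Finset.sum_range]
  refine (Fintype.sum_sigma' fun (p : Fin (k + l + 1)) (σ : Quasishuffle k l p) => _).symm.trans ?_
  refine Fintype.sum_bijective
    (fun s : (Σ p : Fin (k + l + 1), Quasishuffle k l p) =>
      (⟨⟨s.1, s.2.1, s.2.2.1⟩, s.2.2.2⟩ : PackedMapSet _)) ⟨?_, ?_⟩ _ _ fun c => rfl
  · rintro ⟨⟨p, hp⟩, σ, hσ⟩ ⟨⟨q, hq⟩, τ, hτ⟩ h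
    have := congrArg PackedMapSet.map h
    simp only [PackedMap.mk.injEq] at this
    obtain ⟨rfl, h⟩ := this
    obtain rfl := eq_of_heq h
    rfl
  · rintro ⟨c, hc⟩
    have := c.max_le_card
    simp only [Nat.card_eq_fintype_card, Fintype.card_sum, Fintype.card_fin] at this
    exact ⟨⟨⟨c.max, by omega⟩, c.toFun, c.surj, fun i j => hc.1 i j, fun i j => hc.2 i j⟩, rfl⟩

/-- A packed map `e` on `W ⊕ W'` is the same as packed maps `c` and `c'` on the summands together
with a quasishuffle `σ` of their values: `c` and `c'` are the packed restrictions of `e`, and `σ`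
records how their values sit among those of `e`. As `σ` increases strictly on each summand, the
order of `e` restricts to those of `c` and `c'`. -/
theorem qshMul_packedSum {W W' : Type*} [Finite W] [Finite W'] (P : (W → W → Prop) → Prop)
    (P' : (W' → W' → Prop) → Prop) (d : W → V) (d' : W' → V) :
    qshMul (packedSum K P d) (packedSum K P' d') =
      packedSum K (fun R : W ⊕ W' → W ⊕ W' → Prop =>
        P (fun x y => R (Sum.inl x) (Sum.inl y)) ∧ P' (fun x y => R (Sum.inr x) (Sum.inr y)))
        (Sum.elim d d') := by
  simp only [packedSum_apply, map_sum, LinearMap.sum_apply, packedWord_apply (W := W),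
    packedWord_apply (W := W'), qshMul_word_word]
  rw [Finset.sum_comm]
  simp only [← Fintype.sum_sigma']
  let S := Σ c : PackedMapSet P, Σ c' : PackedMapSet P',
    PackedMapSet (SumStrictMono c.map.max c'.map.max)
  have hP : ∀ s : S, P fun x y => s.2.2.map.lt (Sum.inl (s.1.map.toFun x))
      (Sum.inl (s.1.map.toFun y)) := fun s => by
    have : s.1.map.lt = _ := funext₂ fun x y => propext (s.2.2.prop.inl_iff _ _).symm
    exact this ▸ s.1.prop
  have hP' : ∀ s : S, P' fun x y => s.2.2.map.lt (Sum.inr (s.2.1.map.toFun x))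
      (Sum.inr (s.2.1.map.toFun y)) := fun s => by
    have : s.2.1.map.lt = _ := funext₂ fun x y => propext (s.2.2.prop.inr_iff _ _).symm
    exact this ▸ s.2.1.prop
  refine Fintype.sum_bijective
    (fun s : S => (⟨s.2.2.map.comp (f := Sum.map s.1.map.toFun s.2.1.map.toFun)
      (Sum.map_surjective.2 ⟨s.1.map.surj, s.2.1.map.surj⟩), hP s, hP' s⟩ : PackedMapSet _))
    ⟨?_, ?_⟩ _ _ fun s => ?_
  · rintro ⟨⟨c, hc⟩, ⟨c', hc'⟩, ⟨σ, hσ⟩⟩ ⟨⟨e, he⟩, ⟨e', he'⟩, ⟨τ, hτ⟩⟩ h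
    have h := congrArg PackedMapSet.map h
    have hlt : ∀ x y, σ.lt (Sum.map c.toFun c'.toFun x) (Sum.map c.toFun c'.toFun y) ↔
        τ.lt (Sum.map e.toFun e'.toFun x) (Sum.map e.toFun e'.toFun y) := fun x y =>
      iff_of_eq (congrArg (fun c : PackedMap _ => c.lt x y) h)
    obtain rfl : c = e := PackedMap.ext_lt fun x y =>
      (hσ.inl_iff _ _).symm.trans ((hlt (Sum.inl x) (Sum.inl y)).trans (hτ.inl_iff _ _))
    obtain rfl : c' = e' := PackedMap.ext_lt fun x y =>
      (hσ.inr_iff _ _).symm.trans ((hlt (Sum.inr x) (Sum.inr y)).trans (hτ.inr_iff _ _))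
    obtain rfl : σ = τ := PackedMap.comp_injective
      (Sum.map_surjective.2 ⟨c.surj, c'.surj⟩) h
    rfl
  · rintro ⟨e, he, he'⟩
    obtain ⟨c, a, ha, hac⟩ := PackedMap.exists_pack fun x => e.toFun (Sum.inl x)
    obtain ⟨c', a', ha', hac'⟩ := PackedMap.exists_pack fun x => e.toFun (Sum.inr x)
    have hcomp : Sum.elim a a' ∘ Sum.map c.toFun c'.toFun = e.toFun := by
      ext1 x
      rcases x with x | x
      · exact hac x
      · exact hac' x
    let σ : PackedMap (Fin c.max ⊕ Fin c'.max) := ⟨e.max, Sum.elim a a', by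
      refine Function.Surjective.of_comp (g := Sum.map c.toFun c'.toFun) ?_
      rw [hcomp]
      exact e.surj⟩
    have hc : c.lt = fun x y => e.lt (Sum.inl x) (Sum.inl y) := funext₂ fun x y => propext <| by
      rw [PackedMap.lt, PackedMap.lt, ← hac, ← hac, ha.lt_iff_lt]
    have hc' : c'.lt = fun x y => e.lt (Sum.inr x) (Sum.inr y) := funext₂ fun x y => propext <| by
      rw [PackedMap.lt, PackedMap.lt, ← hac', ← hac', ha'.lt_iff_lt]
    refine ⟨⟨⟨c, hc ▸ he⟩, ⟨c', hc' ▸ he'⟩, ⟨σ, fun i j h => ha h, fun i j h => ha' h⟩⟩, ?_⟩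
    refine PackedMapSet.ext (PackedMap.ext_lt fun x y => ?_)
    have := fun x => congrFun hcomp x
    simp only [Function.comp_apply] at this
    exact iff_of_eq (congrArg₂ (· < ·) (this x) (this y))
  · rw [packedWord_apply, packedWord_apply, ← fiberProd_sumMap,
      fiberProd_comp (Sum.map_surjective.2 ⟨s.1.map.surj, s.2.1.map.surj⟩)]
    rfl

/-- The sum over the packed maps satisfying a property on each summand is the iterated product. -/
theorem qshIter_packedSum : ∀ (p : ℕ) {W : Fin p → Type*} [∀ j, Finite (W j)]
    (P : ∀ j, (W j → W j → Prop) → Prop) (d : ∀ j, W j → V),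
    qshIter p (fun j => packedSum K (P j) (d j)) =
      packedSum K (fun R : (Σ j, W j) → (Σ j, W j) → Prop => ∀ j, P j fun x y => R ⟨j, x⟩ ⟨j, y⟩)
        (fun s => d s.1 s.2)
  | 0, W, _, P, d => by
    let c : PackedMap (Σ j, W j) := ⟨0, fun s => s.1.elim0, fun i => i.elim0⟩
    rw [packedSum_eq_packedWord c fun c' =>
      ⟨fun _ => PackedMap.ext_lt fun x => x.1.elim0, fun _ j => j.elim0⟩]
    simp [qshIter, packedWord_apply, word, c]
  | p + 1, W, _, P, d => by
    -- The first factor is split off, following the recursive definition of `qshIter`.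
    let e : (W 0 ⊕ Σ j : Fin p, W j.succ) ≃ Σ j, W j :=
      Equiv.ofBijective (Sum.elim (fun x => ⟨0, x⟩) fun s => ⟨s.1.succ, s.2⟩) <| by
        constructor
        · rintro (x | ⟨j, x⟩) (y | ⟨k, y⟩) h
          · simpa using h
          · exact absurd (congrArg Sigma.fst h) (Fin.succ_ne_zero k).symm
          · exact absurd (congrArg Sigma.fst h) (Fin.succ_ne_zero j)
          · simp only [Sum.elim_inr, Sigma.mk.injEq] at h
            obtain ⟨h, h'⟩ := h
            obtain rfl := Fin.succ_injective _ h
            obtain rfl := eq_of_heq h'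
            rfl
        · rintro ⟨j, x⟩
          induction j using Fin.cases with
          | zero => exact ⟨Sum.inl x, rfl⟩
          | succ j => exact ⟨Sum.inr ⟨j, x⟩, rfl⟩
    have ih := qshIter_packedSum p (fun j => P j.succ) fun j => d j.succ
    have : qshIter (p + 1) (fun j => packedSum K (P j) (d j)) =
        qshMul (packedSum K (P 0) (d 0)) (qshIter p fun j => packedSum K (P j.succ) (d j.succ)) :=
      rfl
    rw [this, ih, qshMul_packedSum]
    have hd : Sum.elim (d 0) (fun s : Σ j : Fin p, W j.succ => d s.1.succ s.2) =
        (fun s : Σ j, W j => d s.1 s.2) ∘ e := by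
      ext x
      rcases x with x | x <;> rfl
    rw [hd, packedSum_equiv]
    refine congrFun (congrArg _ (packedSum_congr fun R => ?_)) _
    exact (Fin.forall_fin_succ (P := fun j => P j fun x y => R ⟨j, x⟩ ⟨j, y⟩)).symm

end PackedSum

/-! ### The colouring map, its product and the counit of `Δ` -/

/-- The strict weak orders of the valid packed colourings of `G`. -/
def Valid {W : Type*} (G : SimpleGraph W) (R : W → W → Prop) : Prop :=
  ∀ x y, G.Adj x y → R x y ∨ R y x

section Morphism

variable (K : Type u) (V : Type v) [Field K] [NonUnitalCommRing V] [Module K V]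
  [IsScalarTower K V V] [SMulCommClass K V V]

/-- The map sending a graph to the sum of the words of its valid packed colourings. -/
def colouringMap : GraphAlg.{u, v, w} K V →ₗ[K] QSh K V :=
  liftGraphs (fun _ _ G => packedSum K (Valid G)) fun W W' _ _ G G' e => by
    ext d
    rw [MultilinearMap.domDomCongr_apply]
    refine (packedSum_equiv e.toEquiv _ d).trans
      (congrFun (congrArg _ (packedSum_congr fun R => ?_)) _)
    refine ⟨fun h x y hxy => ?_, fun h x y hxy => h _ _ (e.map_rel_iff.2 hxy)⟩
    simpa using h (e.symm x) (e.symm y) (e.symm.map_rel_iff.2 hxy)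

variable {K V}

theorem colouringMap_graphMk {W : Type w} [Finite W] (G : SimpleGraph W) (d : W → V) :
    colouringMap K V (graphMk K G d) = packedSum K (Valid G) d := by
  rw [colouringMap, liftGraphs_graphMk]

theorem colouringMap_eq_sum {W : Type w} [Finite W] (G : SimpleGraph W) (d : W → V) :
    colouringMap K V (graphMk K G d) = ∑ c : PackedColouring G,
      word K c.max fun j => dotProd (K := K) {x // c.colour x = j} fun x => d x := by
  rw [colouringMap_graphMk, packedSum_apply]
  symm
  refine Fintype.sum_equiv
    { toFun := fun c => ⟨⟨c.max, c.colour, c.surjective⟩, fun x y h =>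
        (PackedMap.lt_or_lt_iff _ x y).2 (c.valid x y h)⟩
      invFun := fun c => ⟨c.map.max, c.map.toFun, c.map.surj, fun x y h =>
        (PackedMap.lt_or_lt_iff _ x y).1 (c.prop x y h)⟩
      left_inv := fun c => rfl
      right_inv := fun c => rfl } _ _ fun c => rfl

/-- No edge joins the two parts of a disjoint union, so validity is validity on each part, as
required by `qshMul_packedSum`. -/
theorem colouringMap_mul (x y : GraphAlg.{u, v, w} K V) :
    colouringMap K V (graphMul x y) = qshMul (colouringMap K V x) (colouringMap K V y) := by
  have : graphMul.compr₂ (colouringMap K V) =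
      qshMul.compl₁₂ (colouringMap.{u, v, w} K V) (colouringMap.{u, v, w} K V) := by
    refine GraphAlg.hom_ext fun W _ G d => GraphAlg.hom_ext fun W' _ G' d' => ?_
    rw [LinearMap.compr₂_apply, LinearMap.compl₁₂_apply, colouringMap_graphMk,
      colouringMap_graphMk, qshMul_packedSum, graphMul, liftGraphs_graphMk, graphMulLeft_graphMk,
      colouringMap_graphMk]
    refine congrFun (congrArg _ (packedSum_congr fun R => ?_)) _
    constructor
    · exact fun h => ⟨fun x y hxy => h _ _ (by simpa using hxy),
        fun x y hxy => h _ _ (by simpa using hxy)⟩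
    · rintro ⟨h, h'⟩ (x | x) (y | y) hxy
      · exact h x y (by simpa using hxy)
      · simp at hxy
      · simp at hxy
      · exact h' x y (by simpa using hxy)
  exact LinearMap.congr_fun₂ this x y

theorem packedWord_of_isEmpty {W : Type*} [Finite W] [IsEmpty W] (c : PackedMap W) (d : W → V) :
    packedWord K c d = 1 := by
  obtain rfl : c = ⟨0, fun x => isEmptyElim x, fun i => i.elim0⟩ :=
    PackedMap.ext_lt fun x => isEmptyElim x
  simp [packedWord_apply, word]

theorem packedSum_of_isEmpty {W : Type*} [Finite W] [IsEmpty W] {P : (W → W → Prop) → Prop}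
    (hP : ∀ R, P R) (d : W → V) : packedSum K P d = 1 := by
  rw [packedSum_eq_packedWord ⟨0, fun x => isEmptyElim x, fun i => i.elim0⟩ fun c =>
    ⟨fun _ => PackedMap.ext_lt fun x => isEmptyElim x, fun _ => hP _⟩, packedWord_of_isEmpty]

theorem colouringMap_of_isEmpty {W : Type w} [Finite W] [IsEmpty W] (G : SimpleGraph W)
    (d : W → V) : colouringMap K V (graphMk K G d) = 1 := by
  rw [colouringMap_graphMk, packedSum_of_isEmpty (P := Valid G) fun R x => isEmptyElim x]

theorem qshCounitΔ_one : qshCounitΔ (1 : QSh K V) = 1 := by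
  have : (1 : QSh K V) = word K 0 Fin.elim0 := by simp [word]
  rw [this, qshCounitΔ, liftWords_word]
  simp

theorem qshCounitΔ_packedWord {W : Type*} [Finite W] [Nonempty W] (c : PackedMap W) (d : W → V) :
    qshCounitΔ (packedWord K c d) = 0 := by
  rw [packedWord_apply, qshCounitΔ, liftWords_word]
  have := (c.toFun (Classical.arbitrary W)).pos
  obtain ⟨n, hn⟩ : ∃ n, c.max = n + 1 := ⟨c.max - 1, by omega⟩
  obtain ⟨m, c, hc⟩ := c
  subst hn
  rfl

theorem colouringMap_counitΔ (x : GraphAlg.{u, v, w} K V) :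
    qshCounitΔ (colouringMap K V x) = graphCounitΔ x := by
  refine LinearMap.congr_fun (f := qshCounitΔ ∘ₗ colouringMap K V)
    (GraphAlg.hom_ext fun W _ G d => ?_) x
  rw [LinearMap.comp_apply, graphCounitΔ, liftGraphs_graphMk]
  by_cases h : IsEmpty W
  · rw [colouringMap_of_isEmpty, qshCounitΔ_one]
    simp [h]
  · have := not_isEmpty_iff.1 h
    rw [colouringMap_graphMk, packedSum_apply, map_sum]
    simp [qshCounitΔ_packedWord]

/-! ### Deconcatenation: cutting a colouring at a threshold -/

section Deconcatenation

theorem qshΔ_word (n : ℕ) (v : Fin n → V) : qshΔ (word K n v) = ∑ k : Fin (n + 1),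
    word K k (fun i => v (Fin.castLE (Nat.le_of_lt_succ k.2) i)) ⊗ₜ[K]
      word K (n - k) (fun i => v ⟨k + i, by omega⟩) := by
  rw [qshΔ, liftWords_word, sum_apply]
  rfl

theorem word_congr {m n : ℕ} (h : m = n) (v : Fin n → V) :
    word K m (fun i => v (Fin.cast h i)) = word K n v := by
  subst h
  rfl

variable {W : Type*}

open Classical in
/-- The packed map obtained by putting the values on `Aᶜ` after the values on `A`. -/
def PackedMap.concat {A : Set W} (c : PackedMap A) (c' : PackedMap (Aᶜ : Set W)) :
    PackedMap W where
  max := c.max + c'.max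
  toFun x := if h : x ∈ A then Fin.castAdd _ (c.toFun ⟨x, h⟩) else Fin.natAdd _ (c'.toFun ⟨x, h⟩)
  surj i := by
    induction i using Fin.addCases with
    | left i =>
      obtain ⟨x, rfl⟩ := c.surj i
      exact ⟨x, by simp⟩
    | right i =>
      obtain ⟨x, rfl⟩ := c'.surj i
      have : (x : W) ∉ A := x.2
      exact ⟨x, by simp [this]⟩

variable {A : Set W} (c : PackedMap A) (c' : PackedMap (Aᶜ : Set W))

theorem PackedMap.concat_of_mem (x : A) :
    (c.concat c').toFun x = Fin.castAdd c'.max (c.toFun x) := by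
  simp [concat]

theorem PackedMap.concat_of_notMem (x : (Aᶜ : Set W)) :
    (c.concat c').toFun x = Fin.natAdd c.max (c'.toFun x) := by
  have : (x : W) ∉ A := x.2
  simp [concat, this]

/-- The set `A` is thereby recovered from the concatenation and the position of the cut. -/
theorem PackedMap.concat_lt_iff_mem (x : W) : (c.concat c').toFun x < c.max ↔ x ∈ A := by
  by_cases h : x ∈ A
  · have := (c.concat_of_mem c' ⟨x, h⟩)
    simp [this, h]
  · have := (c.concat_of_notMem c' ⟨x, h⟩)
    simp [this, h]

theorem PackedMap.concat_lt_left (x y : A) : (c.concat c').lt x y ↔ c.lt x y := by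
  rw [lt, concat_of_mem, concat_of_mem]
  exact Iff.rfl

theorem PackedMap.concat_lt_right (x y : (Aᶜ : Set W)) : (c.concat c').lt x y ↔ c'.lt x y := by
  rw [lt, concat_of_notMem, concat_of_notMem]
  exact Nat.add_lt_add_iff_left

theorem fiberProd_concat_left [Finite W] (d : W → V) (i : Fin c.max) :
    fiberProd K (c.concat c').toFun d (Fin.castAdd c'.max i) =
      fiberProd K c.toFun (fun x => d x) i := by
  let e : {x : A // c.toFun x = i} ≃ {x // (c.concat c').toFun x = Fin.castAdd c'.max i} :=
    { toFun := fun x => ⟨x.1, by rw [PackedMap.concat_of_mem, x.2]⟩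
      invFun := fun x => ⟨⟨x, (c.concat_lt_iff_mem c' x).1 (by simp [x.2])⟩, by
        rw [← (Fin.castAdd_injective c.max c'.max).eq_iff, ← PackedMap.concat_of_mem]
        exact x.2⟩
      left_inv := fun x => rfl
      right_inv := fun x => rfl }
  exact (dotProd_equiv (K := K) e fun x => d x).symm

theorem fiberProd_concat_right [Finite W] (d : W → V) (i : Fin c'.max) :
    fiberProd K (c.concat c').toFun d (Fin.natAdd c.max i) =
      fiberProd K c'.toFun (fun x => d x) i := by
  let e : {x : (Aᶜ : Set W) // c'.toFun x = i} ≃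
      {x // (c.concat c').toFun x = Fin.natAdd c.max i} :=
    { toFun := fun x => ⟨x.1, by rw [PackedMap.concat_of_notMem, x.2]⟩
      invFun := fun x => ⟨⟨x, fun h => by
          have := (c.concat_lt_iff_mem c' x).2 h
          simp [x.2] at this⟩, by
        rw [← (Fin.natAdd_injective c'.max c.max).eq_iff, ← PackedMap.concat_of_notMem]
        exact x.2⟩
      left_inv := fun x => rfl
      right_inv := fun x => rfl }
  exact (dotProd_equiv (K := K) e fun x => d x).symm

end Deconcatenation

theorem graphΔ_graphMk {W : Type w} [Finite W] [inst : Fintype (Set W)] (G : SimpleGraph W)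
    (d : W → V) : graphΔ (graphMk K G d) = ∑ A : Set W,
      graphMk K (G.induce A) (fun x => d x) ⊗ₜ[K] graphMk K (G.induce Aᶜ) (fun x => d x) := by
  obtain rfl : inst = Fintype.ofFinite (Set W) := Subsingleton.elim _ _
  rw [graphΔ, liftGraphs_graphMk, sum_apply]
  rfl

/-- A valid colouring cut at `k` corresponds to the set `A` of vertices of colour below `k` with
valid colourings of both induced subgraphs. Conversely, any two such colourings concatenate to a
valid one, since an edge between `A` and its complement receives colours on either side of the cut.
-/
theorem colouringMap_coprodΔ (x : GraphAlg.{u, v, w} K V) :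
    qshΔ (colouringMap K V x) =
      TensorProduct.map (colouringMap K V) (colouringMap K V) (graphΔ x) := by
  refine LinearMap.congr_fun (f := qshΔ ∘ₗ colouringMap K V) (g := TensorProduct.map
    (colouringMap K V) (colouringMap K V) ∘ₗ graphΔ) (GraphAlg.hom_ext fun W _ G d => ?_) x
  let _ := Fintype.ofFinite (Set W)
  simp only [LinearMap.comp_apply, colouringMap_graphMk, graphΔ_graphMk, map_sum,
    TensorProduct.map_tmul, packedSum_apply, packedWord_apply, qshΔ_word, TensorProduct.sum_tmul,
    TensorProduct.tmul_sum]
  simp only [← Fintype.sum_sigma']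
  symm
  let S := Σ A : Set W, Σ _ : PackedMapSet (Valid (G.induce Aᶜ)), PackedMapSet (Valid (G.induce A))
  have hG : ∀ s : S, Valid G (s.2.2.map.concat s.2.1.map).lt := fun s x y hxy => by
    by_cases hx : x ∈ s.1 <;> by_cases hy : y ∈ s.1
    · have := s.2.2.prop ⟨x, hx⟩ ⟨y, hy⟩ hxy
      rwa [← PackedMap.concat_lt_left _ s.2.1.map, ← PackedMap.concat_lt_left _ s.2.1.map] at this
    · refine Or.inl ?_
      have h := (PackedMap.concat_lt_iff_mem s.2.2.map s.2.1.map x).2 hx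
      have h' := (PackedMap.concat_lt_iff_mem s.2.2.map s.2.1.map y).not.2 hy
      exact Fin.lt_def.2 (lt_of_lt_of_le h (not_lt.1 h'))
    · refine Or.inr ?_
      have h := (PackedMap.concat_lt_iff_mem s.2.2.map s.2.1.map y).2 hy
      have h' := (PackedMap.concat_lt_iff_mem s.2.2.map s.2.1.map x).not.2 hx
      exact Fin.lt_def.2 (lt_of_lt_of_le h (not_lt.1 h'))
    · have := s.2.1.prop ⟨x, hx⟩ ⟨y, hy⟩ hxy
      rwa [← PackedMap.concat_lt_right s.2.2.map, ← PackedMap.concat_lt_right s.2.2.map] at this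
  refine Fintype.sum_bijective (fun s : S => (⟨⟨s.2.2.map.concat s.2.1.map, hG s⟩,
      ⟨s.2.2.map.max, Nat.lt_succ_of_le (Nat.le_add_right _ _)⟩⟩ :
        Σ c : PackedMapSet (Valid G), Fin (c.map.max + 1)))
    ⟨?_, ?_⟩ _ _ fun s => ?_
  · rintro ⟨A, ⟨c', hc'⟩, ⟨c, hc⟩⟩ ⟨B, ⟨e', he'⟩, ⟨e, he⟩⟩ h
    simp only [Sigma.mk.injEq, PackedMapSet.mk.injEq] at h
    obtain ⟨h, hk⟩ := h
    -- The cut positions lie in types `Fin` whose bounds are equal only through `h`; their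
    -- heterogeneous equality still yields equality of values.
    have hk : c.max = e.max := by
      have hm := congrArg PackedMap.max h
      refine congr_heq (f := fun i : Fin _ => i.val) (g := fun i : Fin _ => i.val) ?_ hk
      rw [hm]
    obtain rfl : A = B := Set.ext fun x => by
      rw [← c.concat_lt_iff_mem c', ← e.concat_lt_iff_mem e', h, hk]
    obtain rfl : c = e := PackedMap.ext_lt fun x y => by
      rw [← c.concat_lt_left c', h, PackedMap.concat_lt_left]
    obtain rfl : c' = e' := PackedMap.ext_lt fun x y => by
      rw [← c.concat_lt_right c', h, PackedMap.concat_lt_right]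
    rfl
  · rintro ⟨⟨c, hc⟩, k⟩
    let A : Set W := {x | c.toFun x < k.1}
    let c₁ : PackedMap A := ⟨k, fun x => ⟨c.toFun x, x.2⟩, fun i => by
      obtain ⟨x, hx⟩ := c.surj (Fin.castLE (Nat.le_of_lt_succ k.2) i)
      have hx' : (c.toFun x : ℕ) = i := by simp [hx]
      exact ⟨⟨x, by simp [A, hx']⟩, Fin.ext hx'⟩⟩
    have hA : ∀ x : (Aᶜ : Set W), k.1 ≤ c.toFun x := fun x => not_lt.1 x.2
    let c₂ : PackedMap (Aᶜ : Set W) := ⟨c.max - k, fun x => ⟨c.toFun x - k, by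
        have := hA x
        omega⟩, fun i => by
      obtain ⟨x, hx⟩ := c.surj ⟨k + i, by omega⟩
      have hx' : (c.toFun x : ℕ) = k + i := by simp [hx]
      exact ⟨⟨x, by simp [A, hx']⟩, Fin.ext (by simp [hx'])⟩⟩
    have hval : ∀ x, ((c₁.concat c₂).toFun x : ℕ) = c.toFun x := fun x => by
      by_cases hx : x ∈ A
      · exact congrArg Fin.val (c₁.concat_of_mem c₂ ⟨x, hx⟩)
      · refine (congrArg Fin.val (c₁.concat_of_notMem c₂ ⟨x, hx⟩)).trans ?_
        exact Nat.add_sub_cancel' (hA ⟨x, hx⟩)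
    -- Comparing orders bypasses the identification of `k + (c.max - k)` with `c.max`.
    have hconcat : c₁.concat c₂ = c := PackedMap.ext_lt fun x y => by
      simp only [PackedMap.lt, Fin.lt_def, hval]
    refine ⟨⟨A, ⟨c₂, fun x y h => ?_⟩, ⟨c₁, fun x y h => ?_⟩⟩, ?_⟩
    · rw [← c₁.concat_lt_right c₂, ← c₁.concat_lt_right c₂, hconcat]
      exact hc _ _ h
    · rw [← c₁.concat_lt_left c₂, ← c₁.concat_lt_left c₂, hconcat]
      exact hc _ _ h
    · refine Sigma.ext (PackedMapSet.ext hconcat) ?_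
      have heq : ∀ e : PackedMap W, e = c → ∀ l : Fin (e.max + 1), (l : ℕ) = k → HEq l k := by
        rintro _ rfl l h
        exact heq_of_eq (Fin.ext h)
      exact heq _ hconcat _ rfl
  · obtain ⟨A, ⟨c', hc'⟩, ⟨c, hc⟩⟩ := s
    refine congrArg₂ _ (congrArg _ ?_) ?_
    · ext1 i
      exact (fiberProd_concat_left c c' d i).symm
    -- The suffix has length `c.max + c'.max - c.max`, which has to be cast to `c'.max`.
    · refine (word_congr (Nat.add_sub_cancel_left c.max c'.max) _).symm.trans (congrArg _ ?_)
      ext1 i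
      exact (fiberProd_concat_right c c' d (Fin.cast (Nat.add_sub_cancel_left _ _) i)).symm

/-! ### The coaction and the counit of `δ` -/

variable [Coalgebra K V] [IsNonUnitalBialgebra K V]

/-- The identity holds for each colouring separately: Sweedler sums pass through fibre products, and
the product of all fibre products is the product of all decorations. -/
theorem colouringMap_coaction (x : GraphAlg.{u, v, w} K V) :
    qshCoaction (colouringMap K V x) =
      TensorProduct.map (colouringMap K V) LinearMap.id (graphCoaction x) := by
  refine LinearMap.congr_fun (f := qshCoaction ∘ₗ colouringMap K V) (g := TensorProduct.map
    (colouringMap K V) LinearMap.id ∘ₗ graphCoaction) (GraphAlg.hom_ext fun W _ G d => ?_) x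
  have h : (colouringMap K V).compMultilinearMap (graphMk K G) = packedSum K (Valid G) :=
    MultilinearMap.ext fun d => colouringMap_graphMk G d
  have h' : LinearMap.id.compMultilinearMap (uProd (K := K) (V := V) W) = uProd W := rfl
  rw [LinearMap.comp_apply, LinearMap.comp_apply, graphCoaction, liftGraphs_graphMk, map_sweedler,
    h, h', packedSum, sweedler_sum_left, colouringMap_graphMk, packedSum_apply, map_sum, sum_apply]
  refine Finset.sum_congr rfl fun c _ => ?_
  rw [packedWord_apply, qshCoaction, liftWords_word, packedWord, ← uProd_fiberwise c.map.surj,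
    ← fiberwise_sweedler c.map.surj]
  rfl

open Classical in
-- The order is empty exactly when the word has at most one letter. That letter is then the product
-- of all decorations, on which `ε_V` is multiplicative.
theorem qshCounitδ_packedWord {W : Type*} [Finite W] (c : PackedMap W) (d : W → V) :
    qshCounitδ (packedWord K c d) = if ∀ x y, ¬ c.lt x y then counitProd W d else 0 := by
  rw [packedWord_apply, qshCounitδ, liftWords_word]
  let _ := Fintype.ofFinite W
  obtain ⟨n, c, hc⟩ := c
  match n, c, hc with
  | 0, c, hc =>
    have : IsEmpty W := ⟨fun x => (c x).elim0⟩
    simp [counitProd_apply]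
  | 1, c, hc =>
    have hlt : ∀ x y, ¬ PackedMap.lt ⟨1, c, hc⟩ x y := fun x y h => by
      have h : c x < c y := h
      omega
    obtain ⟨x, -⟩ := hc 0
    have : Nonempty W := ⟨x⟩
    have h1 : fiberProd K c d 0 = dotProd (K := K) W d :=
      dotProd_equiv (K := K) (Equiv.subtypeUnivEquiv fun x => Subsingleton.elim (c x) 0) d
    rw [if_pos hlt, counitProd_apply, ← counit_dotProd, ← h1]
    simp
  | n + 2, c, hc =>
    have hlt : ¬ ∀ x y, ¬ PackedMap.lt ⟨n + 2, c, hc⟩ x y := fun h => by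
      obtain ⟨x, hx⟩ := hc 0
      obtain ⟨y, hy⟩ := hc 1
      refine h x y ?_
      simp [PackedMap.lt, hx, hy]
    rw [if_neg hlt]
    rfl

/-- Only colourings with at most one colour contribute; an edge excludes them, and an edgeless graph
has exactly one. -/
theorem colouringMap_counitδ (x : GraphAlg.{u, v, w} K V) :
    qshCounitδ (colouringMap K V x) = graphCounitδ x := by
  classical
  refine LinearMap.congr_fun (f := qshCounitδ ∘ₗ colouringMap K V)
    (GraphAlg.hom_ext fun W _ G d => ?_) x
  rw [LinearMap.comp_apply, graphCounitδ, liftGraphs_graphMk, colouringMap_graphMk,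
    packedSum_apply, map_sum]
  simp only [qshCounitδ_packedWord]
  by_cases h : G = ⊥
  · subst h
    -- Packing the map to a point treats the empty graph (no colour) and the others (one colour)
    -- together.
    obtain ⟨c, a, ha, hac⟩ := PackedMap.exists_pack fun _ : W => ()
    have hc : ∀ x y, ¬ c.lt x y := fun x y hxy => lt_irrefl () (ha hxy)
    rw [Fintype.sum_eq_single (⟨c, fun x y h => absurd h (by simp)⟩ : PackedMapSet _) ?_]
    · simp [hc]
    · rintro ⟨c', hc'⟩ hne
      refine if_neg fun h => hne (PackedMapSet.ext (PackedMap.ext_lt fun x y => ?_))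
      simp [h, hc]
  · obtain ⟨x, y, hxy⟩ : ∃ x y, G.Adj x y := by
      by_contra! hn
      exact h (by ext x y; simp [hn])
    rw [if_neg h, Finset.sum_eq_zero fun c _ => if_neg fun hc => ?_]
    · rfl
    · rcases c.prop x y hxy with h | h
      · exact hc _ _ h
      · exact hc _ _ h

end Morphism

/-! ### Compositions as nondecreasing packed maps -/

section Compositions

/-- Equal fibre cardinals make `g` a rearrangement of `f`, and a tuple has only one nondecreasing
rearrangement. -/
theorem eq_of_monotone_of_card_fiber {n : ℕ} {L : Type*} [PartialOrder L] {f g : Fin n → L}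
    (hf : Monotone f) (hg : Monotone g)
    (h : ∀ j, Nat.card {i // f i = j} = Nat.card {i // g i = j}) : f = g := by
  let e : Equiv.Perm (Fin n) := (Equiv.sigmaFiberEquiv g).symm.trans
    ((Equiv.sigmaCongrRight fun j => (Finite.card_eq.1 (h j).symm).some).trans (Equiv.sigmaFiberEquiv f))
  have he : f ∘ e = g := funext fun i => ((Finite.card_eq.1 (h (g i)).symm).some ⟨i, rfl⟩).2
  have := Tuple.unique_monotone (f := f) (σ := e) (τ := Equiv.refl _) (by rwa [he]) hf
  rw [he] at this
  exact this.symm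

theorem monotone_index {n : ℕ} (c : Composition n) : Monotone c.index := by
  intro i j hij
  by_contra h
  have h' : (c.index j : ℕ) + 1 ≤ c.index i := not_le.1 h
  have h1 : (j : ℕ) < c.sizeUpTo (c.index j + 1) := c.lt_sizeUpTo_index_succ j
  have h2 := c.sizeUpTo_index_le i
  have h3 := c.monotone_sizeUpTo h'
  have h4 : (i : ℕ) ≤ j := hij
  omega

theorem card_index {n : ℕ} (c : Composition n) (j : Fin c.length) :
    Nat.card {i // c.index i = j} = c.blocksFun j := by
  have e : {i // c.index i = j} ≃ {s : Σ j, Fin (c.blocksFun j) // s.1 = j} :=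
    c.blocksFinEquiv.symm.subtypeEquiv fun _ => Iff.rfl
  rw [Nat.card_congr (e.trans (Equiv.sigmaSubtype j)), Nat.card_fin]

/-- The index of the block of a composition, as a packed map. -/
def PackedMap.ofComposition {n : ℕ} (c : Composition n) : PackedMap (Fin n) :=
  ⟨c.length, c.index, fun j => ⟨c.embedding j ⟨0, c.blocks_pos' _ j.2⟩, c.index_embedding j _⟩⟩

/-- The strict weak orders of the nondecreasing packed maps. -/
def IsMono {n : ℕ} (R : Fin n → Fin n → Prop) : Prop := ∀ i j, R i j → i < j

theorem PackedMap.isMono_iff {n : ℕ} (m : PackedMap (Fin n)) :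
    IsMono m.lt ↔ Monotone m.toFun :=
  ⟨fun h i j hij => not_lt.1 fun hn => not_lt.2 hij (h j i hn), fun h _ _ hij => h.reflect_lt hij⟩

/-- The cardinals of the fibres of a packed map. -/
def PackedMap.fibreCards {n : ℕ} (m : PackedMap (Fin n)) : List ℕ :=
  List.ofFn fun j => Nat.card {i // m.toFun i = j}

theorem PackedMap.fibreCards_ofComposition {n : ℕ} (c : Composition n) :
    (ofComposition c).fibreCards = c.blocks := by
  rw [← c.ofFn_blocksFun]
  exact congrArg List.ofFn (funext <| card_index c)

theorem PackedMap.eq_of_fibreCards {n : ℕ} {m m' : PackedMap (Fin n)} (hm : IsMono m.lt)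
    (hm' : IsMono m'.lt) (h : m.fibreCards = m'.fibreCards) : m = m' := by
  rw [isMono_iff] at hm hm'
  obtain ⟨p, f, hf⟩ := m
  obtain ⟨q, g, hg⟩ := m'
  obtain rfl : p = q := by simpa [fibreCards] using congrArg List.length h
  obtain rfl : f = g := eq_of_monotone_of_card_fiber hm hm' (congrFun (List.ofFn_injective h))
  rfl

/-- A nondecreasing packed map is determined by its fibre sizes, which are positive by surjectivity
and add up to `n`. -/
theorem PackedMap.ofComposition_bijective (n : ℕ) : Function.Bijective
    (fun c : Composition n => (⟨ofComposition c, (isMono_iff _).2 (monotone_index c)⟩ :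
      PackedMapSet IsMono)) := by
  constructor
  · intro c c' h
    refine Composition.ext ?_
    have h : ofComposition c = ofComposition c' := congrArg PackedMapSet.map h
    rw [← fibreCards_ofComposition, ← fibreCards_ofComposition, h]
  · rintro ⟨m, hm⟩
    let c : Composition n :=
      { blocks := m.fibreCards
        blocks_pos := by
          intro k hk
          obtain ⟨j, rfl⟩ := (List.mem_ofFn' _ _).1 hk
          obtain ⟨i, hi⟩ := m.surj j
          have : Nonempty {i // m.toFun i = j} := ⟨⟨i, hi⟩⟩
          exact Nat.card_pos
        blocks_sum := by
          rw [fibreCards, List.sum_ofFn, ← Nat.card_sigma,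
            Nat.card_congr (Equiv.sigmaFiberEquiv m.toFun), Nat.card_fin] }
    exact ⟨c, PackedMapSet.ext (eq_of_fibreCards ((isMono_iff _).2 (monotone_index c)) hm
      (fibreCards_ofComposition c))⟩

end Compositions

/-! ### The second coproduct through joint colourings -/

/-- The property of being strictly increasing on the fibres of `m`. -/
def StrictOn {n : ℕ} (m : PackedMap (Fin n)) (R : Fin n → Fin n → Prop) : Prop :=
  ∀ i j, i < j → m.toFun i = m.toFun j → R i j

/-- A pair of packed maps which, together, separate adjacent vertices. -/
@[ext]
structure JointColouring {W : Type*} (G : SimpleGraph W) where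
  fst : PackedMap W
  snd : PackedMap W
  valid : ∀ x y, G.Adj x y → fst.toFun x = fst.toFun y → snd.toFun x ≠ snd.toFun y

instance {W : Type*} [Finite W] (G : SimpleGraph W) : Finite (JointColouring G) :=
  Finite.of_injective (fun c => (c.fst, c.snd)) fun _ _ h =>
    JointColouring.ext (congrArg Prod.fst h) (congrArg Prod.snd h)

instance {W : Type*} [Finite W] (G : SimpleGraph W) : Fintype (JointColouring G) :=
  Fintype.ofFinite _

section CoprodDelta

variable {K : Type u} {V : Type v} [Field K] [NonUnitalCommRing V] [Module K V]
  [IsScalarTower K V V] [SMulCommClass K V V]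

/-- Each block word is the sum over strictly increasing packed maps of its block, so
`qshIter_packedSum` only asks for strict increase inside every block. -/
theorem qshIter_blocks {n : ℕ} (c : Composition n) :
    ((qshIter c.length).compMultilinearMap fun j => word (V := V) K (c.blocksFun j)).domDomCongr
      c.blocksFinEquiv = packedSum K (StrictOn (PackedMap.ofComposition c)) := by
  ext v
  have h := qshIter_packedSum (K := K) c.length
    (fun j (R : Fin (c.blocksFun j) → Fin (c.blocksFun j) → Prop) => ∀ i i', i < i' → R i i')
    (fun j i => v (c.blocksFinEquiv ⟨j, i⟩))
  simp only [packedSum_strictMono] at h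
  refine h.trans ((packedSum_equiv c.blocksFinEquiv _ v).trans
    (congrFun (congrArg _ (packedSum_congr fun R => ?_)) _))
  have hc : ∀ s, (PackedMap.ofComposition c).toFun (c.blocksFinEquiv s) = s.1 := fun s =>
    c.index_embedding s.1 s.2
  constructor
  · intro h a b
    obtain ⟨⟨j, i⟩, rfl⟩ := c.blocksFinEquiv.surjective a
    obtain ⟨⟨j', i'⟩, rfl⟩ := c.blocksFinEquiv.surjective b
    intro hij hj
    rw [hc, hc] at hj
    obtain rfl : j = j' := hj
    exact h j i i' ((c.embedding j).lt_iff_lt.1 hij)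
  · intro h j i i' hij
    exact h _ _ ((c.embedding j).lt_iff_lt.2 hij) (by rw [hc, hc])

variable [Coalgebra K V]

theorem qshδ_word (n : ℕ) (v : Fin n → V) : qshδ (word K n v) =
    ∑ m : PackedMapSet (IsMono (n := n)), ∑ σ : PackedMapSet (StrictOn m.map),
      sweedler (packedWord K m.map) (packedWord K σ.map) v := by
  rw [qshδ, liftWords_word, sum_apply]
  refine Fintype.sum_bijective _ (PackedMap.ofComposition_bijective n) _ _ fun c => ?_
  rw [qshIter_blocks, packedSum, sweedler_sum_right, sum_apply]
  rfl

variable [IsNonUnitalBialgebra K V]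

theorem sweedler_fiberProd {W W' : Type*} [Finite W] [Finite W'] {f : W → W'}
    (hf : Function.Surjective f) (σ τ : PackedMap W') (d : W → V) :
    sweedler (packedWord K σ) (packedWord K τ) (fiberProd K f d) =
      sweedler (packedWord K (σ.comp hf)) (packedWord K (τ.comp hf)) d := by
  rw [← fiberwise_packedWord, ← fiberwise_packedWord, ← fiberwise_sweedler hf, fiberwise_apply']

/-- A colouring `c` with `m` nondecreasing and `σ` strictly increasing on the fibres of `m` yields
`f = m ∘ c` and `g = σ ∘ c`. The order of `c` is then the lexicographic order of `(f, g)`, so `c` is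
recovered from the pair, and `m` and `σ` after it. Validity of `c` says that `(f, g)` separates
adjacent vertices. -/
theorem qshδ_packedSum {W : Type*} [Finite W] (G : SimpleGraph W) (d : W → V) :
    qshδ (packedSum K (Valid G) d) =
      ∑ c : JointColouring G, sweedler (packedWord K c.fst) (packedWord K c.snd) d := by
  simp only [packedSum_apply, map_sum, packedWord_apply, qshδ_word]
  simp only [← Fintype.sum_sigma']
  let S := Σ c : PackedMapSet (Valid G), Σ m : PackedMapSet (IsMono (n := c.map.max)),
    PackedMapSet (StrictOn m.map)
  -- Equality of the first coordinates is written as `¬ lt y x`, so that only the two orders enter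
  -- and equal pairs give equal `c` by rewriting.
  have hlex : ∀ (s : S) (x y : W), s.1.map.lt x y ↔ (s.2.1.map.comp s.1.map.surj).lt x y ∨
      ¬ (s.2.1.map.comp s.1.map.surj).lt y x ∧ (s.2.2.map.comp s.1.map.surj).lt x y := by
    rintro ⟨⟨c, hc⟩, ⟨m, hm⟩, ⟨σ, hσ⟩⟩ x y
    have hmono := (PackedMap.isMono_iff m).1 hm
    simp only [PackedMap.lt, PackedMap.comp, Function.comp_apply]
    constructor
    · intro h
      rcases (hmono h.le).lt_or_eq with h' | h'
      · exact Or.inl h'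
      · exact Or.inr ⟨not_lt.2 h'.le, hσ _ _ h h'⟩
    · rintro (h | ⟨h, h'⟩)
      · exact hmono.reflect_lt h
      · by_contra hn
        rcases (not_lt.1 hn).lt_or_eq with h'' | h''
        · exact lt_asymm h' (hσ _ _ h'' (le_antisymm (hmono h''.le) (not_lt.1 h)))
        · rw [h''] at h'
          exact lt_irrefl _ h'
  have hvalid : ∀ (s : S) (x y : W), G.Adj x y →
      (s.2.1.map.comp s.1.map.surj).toFun x = (s.2.1.map.comp s.1.map.surj).toFun y →
      (s.2.2.map.comp s.1.map.surj).toFun x ≠ (s.2.2.map.comp s.1.map.surj).toFun y := by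
    intro s x y hxy hf
    rcases s.1.prop x y hxy with h | h
    · exact ne_of_lt (s.2.2.prop _ _ h hf)
    · exact (ne_of_lt (s.2.2.prop _ _ h hf.symm)).symm
  refine Fintype.sum_bijective (fun s : S => (⟨s.2.1.map.comp s.1.map.surj,
    s.2.2.map.comp s.1.map.surj, hvalid s⟩ : JointColouring G)) ⟨?_, ?_⟩ _ _ fun s => ?_
  · rintro ⟨⟨c, hc⟩, ⟨m, hm⟩, ⟨σ, hσ⟩⟩ ⟨⟨c', hc'⟩, ⟨m', hm'⟩, ⟨σ', hσ'⟩⟩ h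
    have h1 := congrArg JointColouring.fst h
    have h2 := congrArg JointColouring.snd h
    dsimp only at h1 h2
    obtain rfl : c = c' := PackedMap.ext_lt fun x y => by
      rw [hlex ⟨⟨c, hc⟩, ⟨m, hm⟩, ⟨σ, hσ⟩⟩ x y, hlex ⟨⟨c', hc'⟩, ⟨m', hm'⟩, ⟨σ', hσ'⟩⟩ x y]
      dsimp only
      rw [h1, h2]
    obtain rfl : m = m' := PackedMap.comp_injective c.surj h1
    obtain rfl : σ = σ' := PackedMap.comp_injective c.surj h2
    rfl
  · rintro ⟨f, g, hfg⟩
    obtain ⟨c, a, ha, hac⟩ := PackedMap.exists_pack fun x => toLex (f.toFun x, g.toFun x)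
    have ha1 : ∀ x, (ofLex (a (c.toFun x))).1 = f.toFun x := fun x => by rw [hac]; rfl
    have ha2 : ∀ x, (ofLex (a (c.toFun x))).2 = g.toFun x := fun x => by rw [hac]; rfl
    let m : PackedMap (Fin c.max) := ⟨f.max, fun i => (ofLex (a i)).1, fun j => by
      obtain ⟨x, rfl⟩ := f.surj j
      exact ⟨c.toFun x, ha1 x⟩⟩
    let σ : PackedMap (Fin c.max) := ⟨g.max, fun i => (ofLex (a i)).2, fun j => by
      obtain ⟨x, rfl⟩ := g.surj j
      exact ⟨c.toFun x, ha2 x⟩⟩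
    have hm : IsMono m.lt := (PackedMap.isMono_iff m).2 fun i j hij => by
      rcases Prod.Lex.le_iff.1 (ha.monotone hij) with h | h
      · exact h.le
      · exact h.1.le
    have hσ : StrictOn m σ.lt := fun i j hij h => by
      rcases Prod.Lex.lt_iff.1 (ha hij) with h' | h'
      · exact absurd h h'.ne
      · exact h'.2
    have hc : Valid G c.lt := fun x y hxy => (c.lt_or_lt_iff x y).2 fun h =>
      hfg x y hxy (by rw [← ha1, ← ha1, h]) (by rw [← ha2, ← ha2, h])
    refine ⟨⟨⟨c, hc⟩, ⟨m, hm⟩, ⟨σ, hσ⟩⟩, JointColouring.ext ?_ ?_⟩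
    · exact PackedMap.ext_lt fun x y => iff_of_eq (congrArg₂ (· < ·) (ha1 x) (ha1 y))
    · exact PackedMap.ext_lt fun x y => iff_of_eq (congrArg₂ (· < ·) (ha2 x) (ha2 y))
  · exact sweedler_fiberProd s.1.map.surj _ _ _

/-- The edges of `G` joining vertices of the same colour. -/
def monochromatic {W : Type*} (G : SimpleGraph W) (f : PackedMap W) : SimpleGraph W where
  Adj x y := G.Adj x y ∧ f.toFun x = f.toFun y
  symm := ⟨fun _ _ h => ⟨h.1.symm, h.2.symm⟩⟩
  loopless := ⟨fun _ h => G.loopless.irrefl _ h.1⟩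

theorem monochromatic_eq {W : Type*} {G : SimpleGraph W} {f : PackedMap W} {x y : W}
    (h : (monochromatic G f).Reachable x y) : f.toFun x = f.toFun y := by
  obtain ⟨p⟩ := h
  induction p with
  | nil => rfl
  | cons h _ ih => exact h.2.trans ih

/-- The equivalence whose classes are the components of the monochromatic edges. -/
def connEquivOf {W : Type w} (G : SimpleGraph W) (f : PackedMap W) : ConnEquiv G :=
  ⟨(monochromatic G f).reachableSetoid, fun x => by
    have h : {y | (monochromatic G f).reachableSetoid x y} =
        ((monochromatic G f).connectedComponentMk x).supp := by
      ext y
      simp only [SimpleGraph.ConnectedComponent.mem_supp_iff, SimpleGraph.ConnectedComponent.eq]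
      exact ⟨fun h => h.symm, fun h => h.symm⟩
    rw [h]
    -- A component is connected through monochromatic edges, and all the more through edges of `G`.
    exact ((monochromatic G f).connectedComponentMk x).connected_toSimpleGraph.mono
      fun a b (h : (monochromatic G f).Adj a b) => h.1⟩

/-- A class is connected in `G` and `f` is constant on it, so its points are joined by monochromatic
edges; conversely such edges stay within a class. Hence `f` determines the equivalence. -/
theorem connEquiv_iff_reachable {W : Type w} {G : SimpleGraph W} (s : ConnEquiv G)
    {f : PackedMap W} (hs : ∀ x y, s.1 x y → f.toFun x = f.toFun y)
    (hf : ∀ x y, G.Adj x y → f.toFun x = f.toFun y → s.1 x y) (x y : W) :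
    s.1 x y ↔ (monochromatic G f).Reachable x y := by
  constructor
  · intro h
    have := (s.2 x).preconnected ⟨x, s.1.refl x⟩ ⟨y, h⟩
    let φ : G.induce {y | s.1 x y} →g monochromatic G f :=
      { toFun := Subtype.val
        map_rel' := fun {a b} hab => ⟨hab, hs _ _ (s.1.trans (s.1.symm a.2) b.2)⟩ }
    exact this.map φ
  · rintro ⟨p⟩
    induction p with
    | nil => exact s.1.refl _
    | cons h _ ih => exact s.1.trans (hf _ _ h.1 h.2) ih

/-- A valid colouring of `G/∼`, lifted to a map `f` on the vertices, is constant on classes and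
separates adjacent vertices of different classes. So the edges of `G|∼` are exactly the edges on
which `f` is constant, `∼` is the connectedness they generate, and validity of `g` on `G|∼` is the
joint condition on `(f, g)`. -/
theorem colouringMap_graphδ {W : Type w} [Finite W] (G : SimpleGraph W) (d : W → V) :
    TensorProduct.map (colouringMap K V) (colouringMap K V) (graphδ (graphMk K G d)) =
      ∑ c : JointColouring G, sweedler (packedWord K c.fst) (packedWord K c.snd) d := by
  have h : ∀ {W : Type w} [Finite W] (G : SimpleGraph W),
      (colouringMap K V).compMultilinearMap (graphMk K G) = packedSum K (Valid G) := fun G =>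
    MultilinearMap.ext fun d => colouringMap_graphMk G d
  have h' : ∀ s : Setoid W, (colouringMap K V).compMultilinearMap
      (fiberwise (Quotient.mk s) (graphMk (V := V) K (contract G s))) =
      ∑ c : PackedMapSet (Valid (contract G s)),
        packedWord K (c.map.comp (Quotient.mk_surjective (s := s))) := fun s => by
    ext d
    rw [LinearMap.compMultilinearMap_apply, fiberwise_apply', colouringMap_graphMk,
      packedSum_apply, sum_apply]
    refine Finset.sum_congr rfl fun c _ => ?_
    rw [← fiberwise_packedWord, fiberwise_apply']
  have h'' : ∀ s : Setoid W, (colouringMap K V).compMultilinearMap (graphMk K (cut G s)) =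
      ∑ c : PackedMapSet (Valid (cut G s)), packedWord K c.map := fun s => h _
  rw [graphδ, liftGraphs_graphMk, sum_apply]
  simp only [map_sum, map_sweedler, h', h'', sweedler_sum_left, sweedler_sum_right, sum_apply]
  simp only [← Fintype.sum_sigma']
  let S := Σ s : ConnEquiv G, Σ _ : PackedMapSet (Valid (cut G s.1)),
    PackedMapSet (Valid (contract G s.1))
  have hs : ∀ (s : S) (x y : W), s.1.1 x y →
      (s.2.2.map.comp (Quotient.mk_surjective (s := s.1.1))).toFun x =
        (s.2.2.map.comp (Quotient.mk_surjective (s := s.1.1))).toFun y := fun s x y h =>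
    congrArg s.2.2.map.toFun (Quotient.sound h)
  have hf : ∀ (s : S) (x y : W), G.Adj x y →
      (s.2.2.map.comp (Quotient.mk_surjective (s := s.1.1))).toFun x =
        (s.2.2.map.comp (Quotient.mk_surjective (s := s.1.1))).toFun y → s.1.1 x y := by
    intro s x y hxy h
    by_contra hn
    exact (PackedMap.lt_or_lt_iff _ _ _).1
      (s.2.2.prop _ _ ⟨fun h => hn (Quotient.exact h), x, y, rfl, rfl, hxy⟩) h
  refine Fintype.sum_bijective (fun s : S => (⟨s.2.2.map.comp (Quotient.mk_surjective (s := s.1.1)), s.2.1.map,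
    fun x y hxy h => (PackedMap.lt_or_lt_iff _ _ _).1 (s.2.1.prop x y ⟨hxy, hf s x y hxy h⟩)⟩ :
      JointColouring G)) ⟨?_, ?_⟩ _ _ fun s => rfl
  · intro s t h
    have h1 := congrArg JointColouring.fst h
    have h2 := congrArg JointColouring.snd h
    dsimp only at h1 h2
    have hst : s.1 = t.1 := Subtype.ext <| Setoid.ext fun x y => by
      rw [connEquiv_iff_reachable s.1 (hs s) (hf s), connEquiv_iff_reachable t.1 (hs t) (hf t), h1]
    obtain ⟨s, ⟨g, hg⟩, ⟨c, hc⟩⟩ := s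
    obtain ⟨t, ⟨g', hg'⟩, ⟨c', hc'⟩⟩ := t
    obtain rfl : s = t := hst
    obtain rfl : c = c' := PackedMap.comp_injective Quotient.mk_surjective h1
    obtain rfl : g = g' := h2
    rfl
  · rintro ⟨f, g, hfg⟩
    let s := connEquivOf G f
    let c : PackedMap (Quotient s.1) := ⟨f.max, Quotient.lift f.toFun fun x y h =>
        monochromatic_eq h, fun j => by
      obtain ⟨x, rfl⟩ := f.surj j
      exact ⟨Quotient.mk s.1 x, rfl⟩⟩
    refine ⟨⟨s, ⟨g, fun x y h => ?_⟩, ⟨c, ?_⟩⟩, rfl⟩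
    · exact (g.lt_or_lt_iff x y).2 (hfg x y h.1 (monochromatic_eq h.2))
    · rintro _ _ ⟨hne, x, y, rfl, rfl, hxy⟩
      refine (c.lt_or_lt_iff _ _).2 fun h => hne (Quotient.sound ?_)
      exact SimpleGraph.Adj.reachable (G := monochromatic G f) ⟨hxy, h⟩

theorem colouringMap_coprodδ (x : GraphAlg.{u, v, w} K V) :
    qshδ (colouringMap K V x) =
      TensorProduct.map (colouringMap K V) (colouringMap K V) (graphδ x) := by
  refine LinearMap.congr_fun (f := qshδ ∘ₗ colouringMap K V) (g := TensorProduct.map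
    (colouringMap K V) (colouringMap K V) ∘ₗ graphδ) (GraphAlg.hom_ext fun W _ G d => ?_) x
  rw [LinearMap.comp_apply, LinearMap.comp_apply, colouringMap_graphδ, colouringMap_graphMk,
    qshδ_packedSum]

end CoprodDelta

/-! ### Uniqueness by recursion on induced subgraphs -/

section Uniqueness

variable {K : Type u} {V : Type v} [Field K] [NonUnitalCommRing V] [Module K V]
  [IsScalarTower K V V] [SMulCommClass K V V] [Coalgebra K V]

variable (K V) in
/-- The linear map `T(V) → V` which is the identity on words of length one and vanishes on the
other words. -/
def wordProj : QSh K V →ₗ[K] V :=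
  Unitization.sndHom K K V ∘ₗ (TensorProduct.lid K (UnitalExt K V)).toLinearMap ∘ₗ
    TensorProduct.map qshCounitδ LinearMap.id ∘ₗ qshCoaction

theorem wordProj_word (n : ℕ) (v : Fin n → V) : wordProj K V (word K n v) =
    Unitization.sndHom K K V (TensorProduct.lid K (UnitalExt K V)
      (sweedler (qshCounitδ.compMultilinearMap (word K n)) (uProd (K := K) (Fin n)) v)) := by
  simp only [wordProj, LinearMap.comp_apply, qshCoaction, liftWords_word, map_sweedler]
  rfl

/-- On one letter, `ε_δ` is `ε_V`, and the claim is the counit axiom of `V`. -/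
theorem wordProj_one (v : Fin 1 → V) : wordProj K V (word K 1 v) = v 0 := by
  rw [wordProj_word]
  obtain ⟨n, a, b, h⟩ := exists_comul_eq_sum K v
  have h0 := congrArg (fun z => TensorProduct.lid K V
    (TensorProduct.map (Coalgebra.counit (R := K)) LinearMap.id z)) (h 0)
  have hr : TensorProduct.map (Coalgebra.counit (R := K)) LinearMap.id
      (Coalgebra.comul (R := K) (v 0)) = (1 : K) ⊗ₜ[K] v 0 :=
    Coalgebra.rTensor_counit_comul (R := K) (v 0)
  simp only [hr, TensorProduct.lid_tmul, one_smul, map_sum, TensorProduct.map_tmul,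
    LinearMap.id_apply] at h0
  rw [sweedler_apply _ _ v a b h, h0, map_sum, map_sum]
  refine Finset.sum_equiv (Equiv.piUnique _) (by simp) fun s _ => ?_
  simp [qshCounitδ, liftWords_word, uProd_apply]

/-- Longer words are killed by `ε_δ`, and the empty word by the projection `uV → V`, since its
second component under `ρ` is the unit of `uV`. -/
theorem wordProj_of_ne_one {n : ℕ} (hn : n ≠ 1) (v : Fin n → V) :
    wordProj K V (word K n v) = 0 := by
  rw [wordProj_word]
  obtain ⟨m, a, b, h⟩ := exists_comul_eq_sum K v
  rw [sweedler_apply _ _ v a b h, map_sum, map_sum]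
  refine Finset.sum_eq_zero fun s _ => ?_
  match n, hn with
  | 0, _ => simp [uProd_apply]
  | n + 2, _ => simp [qshCounitδ, liftWords_word]

/-- An element of `T(V)` is recovered from its deconcatenation and the first letters of words. -/
theorem eq_counit_add_mul_deconcatenation (x : QSh K V) :
    x = algebraMap K _ (qshCounitΔ x) + LinearMap.mul' K (QSh K V)
      (TensorProduct.map (TensorAlgebra.ι K ∘ₗ wordProj K V) LinearMap.id (qshΔ x)) := by
  refine LinearMap.congr_fun (f := LinearMap.id) (g := (Algebra.linearMap K (QSh K V)) ∘ₗ qshCounitΔ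
    + LinearMap.mul' K (QSh K V) ∘ₗ
      TensorProduct.map (TensorAlgebra.ι K ∘ₗ wordProj K V) LinearMap.id ∘ₗ qshΔ)
    (QSh.hom_ext fun n v => ?_) x
  simp only [LinearMap.id_apply, LinearMap.add_apply, LinearMap.comp_apply, qshΔ_word, map_sum,
    TensorProduct.map_tmul, LinearMap.mul'_apply]
  match n, v with
  | 0, v =>
    rw [Fintype.sum_eq_zero _ fun k => ?_]
    · simp [qshCounitΔ_one, word]
    · rw [wordProj_of_ne_one (by omega)]
      simp
  | n + 1, v =>
    -- Only the cut after the first letter survives `wordProj`, and concatenation (the product of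
    -- the tensor algebra, not the quasishuffle) restores the word.
    rw [Fintype.sum_eq_single (⟨1, by omega⟩ : Fin (n + 2)) fun k hk => ?_]
    · have h : qshCounitΔ (word K (n + 1) v) = 0 := by
        rw [qshCounitΔ, liftWords_word]
        rfl
      have h' : ∀ w : Fin n → V, (∀ i, w i = v i.succ) →
          word K (n + 1) v = TensorAlgebra.ι K (v 0) * word K n w := fun w hw => by
        simp [word, TensorAlgebra.tprod_apply, List.ofFn_succ, hw]
      rw [h, map_zero, zero_add, wordProj_one]
      exact h' _ fun i => congrArg v (Fin.ext (Nat.add_comm 1 i))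
    · rw [wordProj_of_ne_one fun h => hk (Fin.ext h)]
      simp

/-- `wordProj` is built from `ρ` and `ε_δ` alone, which every morphism respects; the right-hand side
no longer involves `Ψ`. -/
theorem wordProj_map {Ψ : GraphAlg.{u, v, w} K V →ₗ[K] QSh K V}
    (h : IsDoubleHom (graphOps K V) (qshOps K V) Ψ) (x : GraphAlg.{u, v, w} K V) :
    wordProj K V (Ψ x) = Unitization.sndHom K K V (TensorProduct.lid K (UnitalExt K V)
      (TensorProduct.map graphCounitδ LinearMap.id (graphCoaction x))) := by
  have h1 : qshCoaction (Ψ x) = TensorProduct.map Ψ LinearMap.id (graphCoaction x) :=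
    h.map_coaction x
  have h2 : qshCounitδ ∘ₗ Ψ = graphCounitδ := LinearMap.ext h.map_counitδ
  simp only [wordProj, LinearMap.comp_apply, h1]
  rw [← LinearMap.comp_apply (TensorProduct.map qshCounitδ LinearMap.id), ← TensorProduct.map_comp,
    h2]
  rfl

/-- Morphisms of double bialgebras from decorated graphs to words are unique. -/
theorem IsDoubleHom.unique {Ψ Φ : GraphAlg.{u, v, w} K V →ₗ[K] QSh K V}
    (hΨ : IsDoubleHom (graphOps K V) (qshOps K V) Ψ)
    (hΦ : IsDoubleHom (graphOps K V) (qshOps K V) Φ) : Ψ = Φ := by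
  have hproj : ∀ x, wordProj K V (Ψ x) = wordProj K V (Φ x) := fun x => by
    rw [wordProj_map hΨ, wordProj_map hΦ]
  -- The reconstruction formula, transported through `Δ` and `ε_Δ`, expresses the value on `G` by
  -- the values on the complements of subsets `A`.
  have hrec : ∀ {Ψ : GraphAlg.{u, v, w} K V →ₗ[K] QSh K V},
      IsDoubleHom (graphOps K V) (qshOps K V) Ψ → ∀ {W : Type w} [Finite W] [Fintype (Set W)]
      (G : SimpleGraph W) (d : W → V),
      Ψ (graphMk K G d) = algebraMap K _ (graphCounitΔ (graphMk K G d)) + ∑ A : Set W,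
        TensorAlgebra.ι K (wordProj K V (Ψ (graphMk K (G.induce A) fun x => d x))) *
          Ψ (graphMk K (G.induce Aᶜ) fun x => d x) := by
    intro Ψ h W _ _ G d
    have h1 : qshΔ (Ψ (graphMk K G d)) = TensorProduct.map Ψ Ψ (graphΔ (graphMk K G d)) :=
      h.map_coprodΔ _
    have h2 : qshCounitΔ (Ψ (graphMk K G d)) = graphCounitΔ (graphMk K G d) := h.map_counitΔ _
    conv_lhs => rw [eq_counit_add_mul_deconcatenation (Ψ (graphMk K G d)), h1, h2, graphΔ_graphMk]
    simp [map_sum]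
  suffices H : ∀ (n : ℕ) (W : Type w) [Finite W] (G : SimpleGraph W) (d : W → V),
      Nat.card W = n → Ψ (graphMk K G d) = Φ (graphMk K G d) from
    GraphAlg.hom_ext fun W _ G d => H _ W G d rfl
  intro n
  induction n using Nat.strong_induction_on with
  | _ n ih =>
    intro W _ G d hn
    let _ := Fintype.ofFinite (Set W)
    rw [hrec hΨ, hrec hΦ]
    refine congrArg _ (Finset.sum_congr rfl fun A _ => ?_)
    rw [hproj]
    -- For `A = ∅` the complement is not smaller, but the coefficient vanishes: the empty graph goes
    -- to the empty word, which has no component in `V`.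
    rcases A.eq_empty_or_nonempty with rfl | hA
    · have h1 : Φ (graphMk K (G.induce (∅ : Set W)) fun x => d x) = word K 0 Fin.elim0 := by
        have h : graphMk K (G.induce (∅ : Set W)) (fun x => d x) = (graphOps K V).one := by
          let e : G.induce (∅ : Set W) ≃g (⊥ : SimpleGraph PEmpty.{w + 1}) :=
            { toEquiv := Equiv.equivOfIsEmpty _ _
              map_rel_iff' := fun {a} => a.2.elim }
          exact (congrArg _ (funext fun x => x.2.elim)).trans
            (graphMk_iso e fun x => x.elim)
        rw [h, hΦ.map_one]
        simp [qshOps, word]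
      rw [h1, wordProj_of_ne_one (by omega)]
      simp
    · rw [ih _ ?_ (Aᶜ : Set W) _ _ rfl]
      obtain ⟨x, hx⟩ := hA
      rw [← hn]
      exact Finite.card_subtype_lt (x := x) (not_not.2 hx)

end Uniqueness

theorem colouringMap_isDoubleHom (K : Type u) (V : Type v) [Field K] [NonUnitalCommRing V]
    [Module K V] [IsScalarTower K V V] [SMulCommClass K V V] [Coalgebra K V]
    [IsNonUnitalBialgebra K V] :
    IsDoubleHom (graphOps K V) (qshOps K V) (colouringMap.{u, v, w} K V) where
  map_one := colouringMap_of_isEmpty _ _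
  map_mul := colouringMap_mul
  map_coprodΔ := colouringMap_coprodΔ
  map_counitΔ := colouringMap_counitΔ
  map_coprodδ := colouringMap_coprodδ
  map_counitδ := colouringMap_counitδ
  map_coaction := colouringMap_coaction

end GraphQSh

end

theorem mainTheorem11 (K : Type u) [Field K] [CharZero K]
    (V : Type v) [NonUnitalCommRing V] [Module K V] [IsScalarTower K V V] [SMulCommClass K V V]
    [Coalgebra K V] [IsNonUnitalBialgebra K V] :
    ∃ Φ : GraphAlg.{u, v, w} K V →ₗ[K] QSh K V,
      IsDoubleHom (graphOps K V) (qshOps K V) Φ ∧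
      (∀ Ψ : GraphAlg.{u, v, w} K V →ₗ[K] QSh K V,
        IsDoubleHom (graphOps K V) (qshOps K V) Ψ → Ψ = Φ) ∧
      ∀ (W : Type w) [Finite W] (G : SimpleGraph W) (d : W → V),
        Φ (graphMk K G d) =
          ∑ c : PackedColouring G,
            word K c.max fun j => dotProd (K := K) {x // c.colour x = j} fun x => d x := by
  have h := colouringMap_isDoubleHom.{u, v, w} K V
  exact ⟨colouringMap K V, h, fun Ψ hΨ => hΨ.unique h, fun W _ G d => colouringMap_eq_sum G d⟩
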